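/- For each $n\in\mathbb N$ let $\mathcal D_n$ be an arbitrary probability distribution over pairs $(H,t)$, where $H$ is a Hermitian operator on $n$ qubits (a Hamiltonian) and $t\in\mathbb R$ an evolution time, and let $\mathcal E_n=\{e^{-iHt} : (H,t)\sim\mathcal D_n\}$ be the resulting ensemble of random unitaries in $U(2^n)$. Let $q:\mathbb N\to\mathbb N$. Suppose that one of the following holds. 1. (One-dimensional systems.) For every $n$, almost every $H$ drawn from $\mathcal D_n$ is a real linear combination of $n$-qubit Pauli strings each of which acts non-trivially only within some window of $q(n)$ consecutive sites (of an open chain or a ring of $n$ sites), and $q(n)=\mathcal O(\log n)$. 2. (All-to-all connected systems.) For every $n$, almost every $H$ drawn from $\mathcal D_n$ is a real linear combination of $n$-qubit Pauli strings of weight at most $q(n)$, and $q(n)=\mathcal O(1)$. Then $\mathcal E=(\mathcal E_n)_n$ is not a pseudorandom unitary (PRU) with security against polynomial-time quantum adversaries. Here a quantum adversary $\mathcal A$ is a family of quantum circuits that may apply the unknown $n$-qubit unitary $U$ as a gate, at any places in the circuit, and that output one measured bit; it is polynomial-time if the circuit for $n$ has polynomially many qubits and its description can be computed from $n$ in time polynomial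 in $n$; and $\mathcal E$ is a PRU if for every polynomial-time $\mathcal A$ the advantage $$\Bigl|\,\mathbb E_{U\sim\mathcal E_n}\Pr[\mathcal A^U=1]-\mathbb E_{U\sim\mathrm{Haar}(2^n)}\Pr[\mathcal A^U=1]\,\Bigr|$$ is negligible, i.e. decays faster than every inverse polynomial in $n$. In fact there is a polynomial-time adversary that makes only two queries to $U$, in parallel, and whose advantage is not negligible. -/

import Mathlib

open MeasureTheory Filter

noncomputable section

namespace NoGoPRU

/-! ### Qubits, unitaries and the Haar measure -/

/-- Bit strings of length `n`: the labels of the computational basis of `n` qubits. -/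
abbrev Bits (n : ℕ) : Type := Fin n → Fin 2

/-- Operators on `n` qubits. -/
abbrev Op (n : ℕ) : Type := Matrix (Bits n) (Bits n) ℂ

/-- The unitary group `U(2^n)`. -/
abbrev UGroup (n : ℕ) : Type := Matrix.unitaryGroup (Bits n) ℂ

instance instMeasurableSpaceUGroup (n : ℕ) : MeasurableSpace (UGroup n) := borel _

instance instBorelSpaceUGroup (n : ℕ) : BorelSpace (UGroup n) := ⟨rfl⟩

instance instCompactSpaceUGroup (n : ℕ) : CompactSpace (UGroup n) := by
  apply isCompact_iff_compactSpace.mp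
  have hK : IsCompact
      (Set.univ.pi fun _ : Bits n => Set.univ.pi fun _ : Bits n =>
        Metric.closedBall (0 : ℂ) 1) :=
    isCompact_univ_pi fun _ => isCompact_univ_pi fun _ => isCompact_closedBall 0 1
  have hc : IsClosed ((Matrix.unitaryGroup (Bits n) ℂ : Set (Op n))) := by
    have : ((Matrix.unitaryGroup (Bits n) ℂ : Set (Op n)))
        = {A : Op n | A * A.conjTranspose = 1} := by
      ext A
      exact Matrix.mem_unitaryGroup_iff
    rw [this]
    exact isClosed_eq (continuous_id.matrix_mul continuous_id.matrix_conjTranspose)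
      continuous_const
  refine hK.of_isClosed_subset hc fun A hA => ?_
  intro i _ j _
  rw [mem_closedBall_zero_iff]
  exact entry_norm_bound_of_unitary hA i j

/-- The Haar probability measure on `U(2^n)`. -/
def haar (n : ℕ) : Measure (UGroup n) := Measure.haarMeasure ⊤

/-! ### Local Hamiltonians and their time evolution -/

/-- Hamiltonians on `n` qubits: Hermitian matrices, with their Borel σ-algebra. -/
abbrev Hamiltonian (n : ℕ) : Type := selfAdjoint (Op n)

instance instMeasurableSpaceHamiltonian (n : ℕ) : MeasurableSpace (Hamiltonian n) := borel _

instance instBorelSpaceHamiltonian (n : ℕ) : BorelSpace (Hamiltonian n) := ⟨rfl⟩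

/-- The single-qubit Pauli labels. -/
inductive Pauli
  | I
  | X
  | Y
  | Z
  deriving DecidableEq

instance instFintypePauli : Fintype Pauli :=
  ⟨{Pauli.I, Pauli.X, Pauli.Y, Pauli.Z}, fun a => by cases a <;> decide⟩

/-- The single-qubit Pauli matrices. -/
def Pauli.mat : Pauli → Matrix (Fin 2) (Fin 2) ℂ
  | .I => !![1, 0; 0, 1]
  | .X => !![0, 1; 1, 0]
  | .Y => !![0, -Complex.I; Complex.I, 0]
  | .Z => !![1, 0; 0, -1]

/-- Pauli strings on `n` qubits. -/
abbrev PauliString (n : ℕ) : Type := Fin n → Pauli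

/-- The tensor product of the Pauli matrices of a Pauli string. -/
def PauliString.toOp {n : ℕ} (P : PauliString n) : Op n :=
  Matrix.of fun x y => ∏ i, (P i).mat (x i) (y i)

/-- The number of qubits on which a Pauli string acts non-trivially. -/
def PauliString.weight {n : ℕ} (P : PauliString n) : ℕ :=
  (Finset.univ.filter fun i => P i ≠ Pauli.I).card

/-- The Pauli string acts non-trivially only inside some window of `q` consecutive sites
`a, a + 1, …, a + q - 1`. Sites are read modulo `n`, so that both the open chain (windows that do
not wrap around) and the ring are covered. -/
def PauliString.InWindow {n : ℕ} (q : ℕ) (P : PauliString n) : Prop :=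
  ∃ a : ℕ, ∀ i : Fin n, P i ≠ Pauli.I → ∃ j < q, (i : ℕ) = (a + j) % n

/-- `H = ∑ h_P P` with real coefficients, where all Pauli strings that appear satisfy `S`. -/
def IsPauliSum {n : ℕ} (S : PauliString n → Prop) (H : Hamiltonian n) : Prop :=
  ∃ h : PauliString n → ℝ, (∀ P, h P ≠ 0 → S P) ∧
    (H : Op n) = ∑ P, (h P : ℂ) • PauliString.toOp P

/-- `q`-local Hamiltonians with all-to-all connectivity. -/
def IsLocal {n : ℕ} (q : ℕ) (H : Hamiltonian n) : Prop :=
  IsPauliSum (fun P => PauliString.weight P ≤ q) H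

/-- Geometrically `q`-local Hamiltonians in one dimension. -/
def IsLocal1D {n : ℕ} (q : ℕ) (H : Hamiltonian n) : Prop :=
  IsPauliSum (PauliString.InWindow q) H

/-- The time-evolution operator `exp(-i H t)`. -/
def evolution {n : ℕ} (p : Hamiltonian n × ℝ) : UGroup n :=
  ⟨NormedSpace.exp ((-(Complex.I * (p.2 : ℂ))) • (p.1 : Op n)), by
    have hH : ((p.1 : Op n)).conjTranspose = (p.1 : Op n) := p.1.2
    rw [Matrix.mem_unitaryGroup_iff, Matrix.star_eq_conjTranspose, ← Matrix.exp_conjTranspose,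
      Matrix.conjTranspose_smul, hH]
    have hs : star (-(Complex.I * (p.2 : ℂ))) = -(-(Complex.I * (p.2 : ℂ))) := by
      simp
    rw [hs, neg_smul (-(Complex.I * (p.2 : ℂ))), ← Matrix.exp_add_of_commute _ _
      (Commute.neg_right (Commute.refl ((-(Complex.I * (p.2 : ℂ))) • (p.1 : Op n)))), add_neg_cancel, NormedSpace.exp_zero]⟩

/-- The unitary ensemble `{exp(-i H t) | (H, t) ∼ D}`, as a measure on the unitary group. -/
def evolutionEnsemble {n : ℕ} (D : Measure (Hamiltonian n × ℝ)) : Measure (UGroup n) :=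
  D.map evolution

/-! ### Quantum circuits with oracle queries -/

/-- The elementary operations of a circuit: a universal finite gate set, and a query to the
unknown `n`-qubit unitary. -/
inductive GateKind
  | X
  | H
  | T
  | CNOT
  | Toffoli
  | query
  deriving DecidableEq

/-- The number of wires on which an operation acts. -/
@[reducible]
def GateKind.arity (n : ℕ) : GateKind → ℕ
  | .X => 1
  | .H => 1
  | .T => 1
  | .CNOT => 2
  | .Toffoli => 3
  | .query => n

/-- The matrix of an operation, where `U` is the unknown unitary. Addition and multiplication of
bits are modulo 2. -/
def GateKind.matrix {n : ℕ} (U : UGroup n) : (k : GateKind) → Op (k.arity n)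
  | .X => Matrix.of fun (x y : Bits 1) => (!![0, 1; 1, 0] : Matrix (Fin 2) (Fin 2) ℂ) (x 0) (y 0)
  | .H => Matrix.of fun (x y : Bits 1) =>
      ((1 / Real.sqrt 2 : ℝ) : ℂ) * (!![1, 1; 1, -1] : Matrix (Fin 2) (Fin 2) ℂ) (x 0) (y 0)
  | .T => Matrix.of fun (x y : Bits 1) =>
      (!![1, 0; 0, Complex.exp (Complex.I * (Real.pi / 4))] : Matrix (Fin 2) (Fin 2) ℂ) (x 0) (y 0)
  | .CNOT => Matrix.of fun (x y : Bits 2) => if x 0 = y 0 ∧ x 1 = y 1 + y 0 then 1 else 0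
  | .Toffoli => Matrix.of fun (x y : Bits 3) =>
      if x 0 = y 0 ∧ x 1 = y 1 ∧ x 2 = y 2 + y 0 * y 1 then 1 else 0
  | .query => (U : Op n)

/-- The code number of an operation. -/
def GateKind.code : GateKind → ℕ
  | .X => 0
  | .H => 1
  | .T => 2
  | .CNOT => 3
  | .Toffoli => 4
  | .query => 5

/-- An operation placed on distinct wires of an `m`-qubit register. -/
structure Gate (n m : ℕ) where
  kind : GateKind
  wires : Fin (kind.arity n) ↪ Fin m

open Classical in
/-- The operator `A ⊗ 1` on `m` qubits, where `A` acts on the wires in the range of `e`. -/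
def onWires {k m : ℕ} (e : Fin k ↪ Fin m) (A : Op k) : Op m :=
  Matrix.of fun x y => if ∀ j, j ∉ Set.range e → x j = y j then A (x ∘ e) (y ∘ e) else 0

/-- The operator that a placed operation applies to the register. -/
def Gate.op {n m : ℕ} (U : UGroup n) (g : Gate n m) : Op m :=
  onWires g.wires (g.kind.matrix U)

/-- A circuit: a register of `width` qubits (including all ancillas), a sequence of
operations, and the wire that is measured at the end. -/
structure Circuit (n : ℕ) where
  width : ℕ
  gates : List (Gate n width)
  out : Fin width

/-- The final state of the circuit, started in `|0…0⟩`. -/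
def Circuit.finalState {n : ℕ} (C : Circuit n) (U : UGroup n) : Bits C.width → ℂ :=
  C.gates.foldl (fun ψ g => (g.op U).mulVec ψ) (Pi.single 0 1)

/-- The probability that the final measurement of the output wire returns `1`. -/
def Circuit.acceptProb {n : ℕ} (C : Circuit n) (U : UGroup n) : ℝ :=
  ∑ x : Bits C.width, if x C.out = 1 then ‖C.finalState U x‖ ^ 2 else 0

/-- The description of a circuit as a list of numbers: the width, the output wire, and then for
each operation its code number followed by the wires on which it acts. -/
def Circuit.encode {n : ℕ} (C : Circuit n) : List ℕ :=
  C.width :: (C.out : ℕ) ::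
    C.gates.flatMap fun g => g.kind.code :: List.ofFn fun i => (g.wires i : ℕ)

/-- All queries of the circuit are made at once, in parallel on disjoint sets of wires, and there
are exactly `k` of them. -/
def Circuit.ParallelQueries {n : ℕ} (C : Circuit n) (k : ℕ) : Prop :=
  ∃ pre qs post : List (Gate n C.width), C.gates = pre ++ qs ++ post ∧
    (∀ g ∈ pre, g.kind ≠ .query) ∧ (∀ g ∈ post, g.kind ≠ .query) ∧
    (∀ g ∈ qs, g.kind = .query) ∧ qs.length = k ∧
    qs.Pairwise fun g h => ∀ i j, g.wires i ≠ h.wires j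

/-! ### Classical polynomial time

Programs of a random access machine: memory cells indexed by `ℕ` hold natural numbers, the
arithmetic operations are addition and truncated subtraction, addressing is direct or indirect,
control flow is by `if` and `while`, each elementary step has unit cost, and there is a write-only
output tape. Within polynomial factors this is equivalent to Turing machine time. -/

/-- Programs of the random access machine. -/
inductive Prog
  /-- `M[r] := c` -/
  | const (r c : ℕ)
  /-- `M[r] := M[s]` -/
  | copy (r s : ℕ)
  /-- `M[r] := M[r] + M[s]` -/
  | plus (r s : ℕ)
  /-- `M[r] := M[r] - M[s]`, truncated at `0` -/
  | minus (r s : ℕ)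
  /-- `M[r] := M[M[s]]` -/
  | load (r s : ℕ)
  /-- `M[M[r]] := M[s]` -/
  | store (r s : ℕ)
  /-- write `M[r]` on the output tape -/
  | emit (r : ℕ)
  /-- run one program, then another -/
  | seq (p p' : Prog)
  /-- if `M[r] ≠ 0` run the first program, otherwise the second -/
  | cond (r : ℕ) (p p' : Prog)
  /-- while `M[r] ≠ 0` run the program -/
  | loop (r : ℕ) (p : Prog)

/-- Memory contents and output tape. -/
structure MState where
  mem : ℕ → ℕ
  out : List ℕ

/-- Set one memory cell. -/
def MState.write (s : MState) (r v : ℕ) : MState := ⟨Function.update s.mem r v, s.out⟩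

/-- `Exec p s s' t`: the program `p`, started in state `s`, halts in state `s'` after exactly `t`
steps. -/
inductive Exec : Prog → MState → MState → ℕ → Prop
  | const (r c : ℕ) (s : MState) : Exec (.const r c) s (s.write r c) 1
  | copy (r r' : ℕ) (s : MState) : Exec (.copy r r') s (s.write r (s.mem r')) 1
  | plus (r r' : ℕ) (s : MState) : Exec (.plus r r') s (s.write r (s.mem r + s.mem r')) 1
  | minus (r r' : ℕ) (s : MState) : Exec (.minus r r') s (s.write r (s.mem r - s.mem r')) 1
  | load (r r' : ℕ) (s : MState) : Exec (.load r r') s (s.write r (s.mem (s.mem r'))) 1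
  | store (r r' : ℕ) (s : MState) : Exec (.store r r') s (s.write (s.mem r) (s.mem r')) 1
  | emit (r : ℕ) (s : MState) : Exec (.emit r) s ⟨s.mem, s.out ++ [s.mem r]⟩ 1
  | seq {p p' : Prog} {s₁ s₂ s₃ : MState} {t t' : ℕ} (h : Exec p s₁ s₂ t)
      (h' : Exec p' s₂ s₃ t') : Exec (.seq p p') s₁ s₃ (t + t')
  | condTrue {r : ℕ} {p p' : Prog} {s₁ s₂ : MState} {t : ℕ} (hr : s₁.mem r ≠ 0)
      (h : Exec p s₁ s₂ t) : Exec (.cond r p p') s₁ s₂ (t + 1)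
  | condFalse {r : ℕ} {p p' : Prog} {s₁ s₂ : MState} {t : ℕ} (hr : s₁.mem r = 0)
      (h : Exec p' s₁ s₂ t) : Exec (.cond r p p') s₁ s₂ (t + 1)
  | loopStop {r : ℕ} {p : Prog} {s : MState} (hr : s.mem r = 0) : Exec (.loop r p) s s 1
  | loopStep {r : ℕ} {p : Prog} {s₁ s₂ s₃ : MState} {t t' : ℕ} (hr : s₁.mem r ≠ 0)
      (h : Exec p s₁ s₂ t) (h' : Exec (.loop r p) s₂ s₃ t') :
      Exec (.loop r p) s₁ s₃ (t + t' + 1)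

/-- The initial state on input `n`: `n` stands in cell `0`, everything else is blank. -/
def MState.init (n : ℕ) : MState := ⟨Function.update (fun _ => 0) 0 n, []⟩

/-! ### Quantum adversaries and pseudorandom unitaries -/

/-- A quantum experiment: for each `n` a circuit that queries an `n`-qubit unitary. -/
abbrev Experiment : Type := (n : ℕ) → Circuit n

/-- The experiment runs in time polynomial in `n`: its circuits have polynomially many qubits, and
one program writes down the `n`-th circuit in a number of steps polynomial in `n` (so the number of
gates is polynomial too, and the family is uniform). -/
def Experiment.PolyTime (A : Experiment) : Prop :=
  ∃ (prog : Prog) (p : Polynomial ℕ), ∀ n : ℕ, (A n).width ≤ p.eval n ∧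
    ∃ (s : MState) (t : ℕ), Exec prog (MState.init n) s t ∧ t ≤ p.eval n ∧ s.out = (A n).encode

/-- The advantage of an experiment in distinguishing the ensemble `E n` from Haar-random unitaries
on `n` qubits. -/
def advantage (A : Experiment) (E : (n : ℕ) → Measure (UGroup n)) (n : ℕ) : ℝ :=
  |(∫ U, (A n).acceptProb U ∂(E n)) - ∫ U, (A n).acceptProb U ∂(haar n)|

/-- A function of `n` is negligible if it decays faster than every inverse polynomial. -/
def Negligible (f : ℕ → ℝ) : Prop :=
  Asymptotics.SuperpolynomialDecay atTop (fun n : ℕ => (n : ℝ)) f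

/-- The ensembles `E n` form a pseudorandom unitary: no polynomial-time quantum experiment, which
may query the unitary adaptively, distinguishes them from Haar-random with non-negligible
advantage. -/
def IsPRU (E : (n : ℕ) → Measure (UGroup n)) : Prop :=
  ∀ A : Experiment, A.PolyTime → Negligible (advantage A E)

end NoGoPRU

end

/-!
Conjugation by `U = e^{-iHt}` fixes `H`, so the coefficient vector of `H` is a fixed vector of the
Pauli transfer matrix `2⁻ⁿ tr(P U Q U†)`. By Cauchy–Schwarz, the squares of the entries with `P`
and `Q` in the support of `H` add up to at least `1`. For a Haar-random `U` the mean square of an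
entry with `P` nontrivial is at most `2 / 4ⁿ`, because the rows `P` and `P'` have the same
distribution and half of all strings `P'` anticommute with `P`.

Let `S` be the swap of two copies of a set `w` of sites, which is `2^{-|w|}` times the sum of
`P ⊗ P` over the strings `P` within `w`, and let `V = U ⊗ U`. An interferometer whose arms apply
`S V` and `V S` to a random basis state measures the mean square of `S V - V S`, hence the sum of
the squared entries between the strings within `w`. It suffices to choose `w` at random in such a
way that every union of `O(1)` intervals with `O(log n)` sites in total has inverse polynomial
probability: the marks form a Markov chain in which the start of an interval costs a factor of
order `1 / n` and every further site a constant factor. Under this distribution the mean of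
`4^|w|` is at most `(5/2)ⁿ`, so the Haar average of the signal is still of order at most `(5/8)ⁿ`.
-/

open MeasureTheory Filter
open scoped Kronecker

noncomputable section

namespace NoGoPRU

variable {n k m : ℕ}

/-! ### Pauli strings -/

/-- The commutation sign of two Pauli matrices: `1` if they commute and `-1` if they
anticommute. -/
def Pauli.sign (a b : Pauli) : ℤ := if a = .I ∨ b = .I ∨ a = b then 1 else -1

lemma Pauli.sum_univ {M : Type*} [AddCommMonoid M] (f : Pauli → M) :
    ∑ a, f a = f .I + (f .X + (f .Y + f .Z)) := by
  have huniv : (Finset.univ : Finset Pauli) = {Pauli.I, Pauli.X, Pauli.Y, Pauli.Z} := rfl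
  rw [huniv, Finset.sum_insert (by decide), Finset.sum_insert (by decide),
    Finset.sum_insert (by decide), Finset.sum_singleton]

lemma Pauli.sum_sign {a : Pauli} (ha : a ≠ .I) : ∑ b, a.sign b = 0 := by
  revert ha
  cases a <;> decide

lemma Pauli.mat_mul_comm (a b : Pauli) :
    a.mat * b.mat = (a.sign b : ℂ) • (b.mat * a.mat) := by
  cases a <;> cases b <;> ext i j <;> fin_cases i <;> fin_cases j <;>
    simp [Pauli.mat, Pauli.sign, Matrix.mul_apply, Fin.sum_univ_two]

lemma Pauli.mat_I : Pauli.I.mat = 1 := by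
  ext i j
  fin_cases i <;> fin_cases j <;> simp [Pauli.mat]

lemma Pauli.mat_mul_self (a : Pauli) : a.mat * a.mat = 1 := by
  cases a <;> ext i j <;> fin_cases i <;> fin_cases j <;>
    simp [Pauli.mat, Matrix.mul_apply, Fin.sum_univ_two]

lemma Pauli.star_mat_apply (a : Pauli) (i j : Fin 2) : star (a.mat i j) = a.mat j i := by
  cases a <;> fin_cases i <;> fin_cases j <;> simp [Pauli.mat]

lemma Pauli.trace_mat_mul_mat (a b : Pauli) :
    (a.mat * b.mat).trace = if a = b then 2 else 0 := by
  cases a <;> cases b <;>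
    simp [Pauli.mat, Matrix.trace, Fin.sum_univ_two] <;> norm_num

lemma Pauli.sum_mat_mul_mat (x y x' y' : Fin 2) :
    ∑ a : Pauli, a.mat x y * a.mat x' y' = if y = x' ∧ y' = x then 2 else 0 := by
  rw [Pauli.sum_univ]
  fin_cases x <;> fin_cases y <;> fin_cases x' <;> fin_cases y' <;>
    simp [Pauli.mat] <;> norm_num

lemma sum_prod_eq_prod_sum {ι κ R : Type*} [Fintype ι] [DecidableEq ι] [Fintype κ]
    [CommSemiring R] (f : ι → κ → R) : ∑ z : ι → κ, ∏ i, f i (z i) = ∏ i, ∑ b, f i b := by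
  rw [Finset.prod_univ_sum, Fintype.piFinset_univ]

/-- The identity string. -/
def PauliString.one (n : ℕ) : PauliString n := fun _ => .I

/-- The commutation sign of two Pauli strings: `1` if they commute and `-1` if they
anticommute. -/
def PauliString.sign (P Q : PauliString n) : ℤ := ∏ i, (P i).sign (Q i)

lemma PauliString.sign_eq_one_or (P Q : PauliString n) : P.sign Q = 1 ∨ P.sign Q = -1 := by
  refine Int.isUnit_iff.mp (Finset.prod_induction _ IsUnit (fun _ _ => IsUnit.mul) isUnit_one ?_)
  intro i _
  unfold Pauli.sign
  split_ifs <;> decide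

lemma PauliString.sum_sign {P : PauliString n} (hP : P ≠ PauliString.one n) :
    ∑ Q, P.sign Q = 0 := by
  obtain ⟨i, hi⟩ : ∃ i, P i ≠ .I := Function.ne_iff.mp hP
  unfold PauliString.sign
  rw [sum_prod_eq_prod_sum fun i b => (P i).sign b]
  exact Finset.prod_eq_zero (Finset.mem_univ i) (Pauli.sum_sign hi)

lemma PauliString.toOp_mul_toOp_apply (P Q : PauliString n) (x y : Bits n) :
    (P.toOp * Q.toOp) x y = ∏ i, ((P i).mat * (Q i).mat) (x i) (y i) := by
  simp only [Matrix.mul_apply, PauliString.toOp, Matrix.of_apply, ← Finset.prod_mul_distrib]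
  exact sum_prod_eq_prod_sum fun i b => (P i).mat (x i) b * (Q i).mat b (y i)

lemma PauliString.toOp_mul_comm (P Q : PauliString n) :
    P.toOp * Q.toOp = (P.sign Q : ℂ) • (Q.toOp * P.toOp) := by
  ext x y
  rw [Matrix.smul_apply, toOp_mul_toOp_apply, toOp_mul_toOp_apply, smul_eq_mul,
    PauliString.sign, Int.cast_prod, ← Finset.prod_mul_distrib]
  refine Finset.prod_congr rfl fun i _ => ?_
  rw [Pauli.mat_mul_comm, Matrix.smul_apply, smul_eq_mul]

lemma PauliString.toOp_mul_self (P : PauliString n) : P.toOp * P.toOp = 1 := by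
  ext x y
  simp only [toOp_mul_toOp_apply, Pauli.mat_mul_self, Matrix.one_apply, Finset.prod_ite_zero]
  simp [funext_iff]

lemma PauliString.toOp_one : (PauliString.one n).toOp = 1 := by
  ext x y
  simp only [PauliString.toOp, PauliString.one, Matrix.of_apply, Pauli.mat_I, Matrix.one_apply,
    Finset.prod_ite_zero]
  simp [funext_iff]

lemma PauliString.isSelfAdjoint_toOp (P : PauliString n) : IsSelfAdjoint P.toOp := by
  ext x y
  simp only [Matrix.star_apply, PauliString.toOp, Matrix.of_apply, star_prod]
  exact Finset.prod_congr rfl fun i _ => Pauli.star_mat_apply _ _ _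

lemma PauliString.trace_toOp_mul_toOp (P Q : PauliString n) :
    (P.toOp * Q.toOp).trace = if P = Q then 2 ^ n else 0 := by
  have hsite (i : Fin n) : ∑ b, ((P i).mat * (Q i).mat) b b = if P i = Q i then 2 else 0 :=
    Pauli.trace_mat_mul_mat _ _
  simp only [Matrix.trace, Matrix.diag, toOp_mul_toOp_apply]
  rw [sum_prod_eq_prod_sum fun i b => ((P i).mat * (Q i).mat) b b]
  simp only [hsite, Finset.prod_ite_zero]
  simp [funext_iff]

lemma PauliString.trace_toOp_mul_sum (h : PauliString n → ℂ) (P : PauliString n) :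
    (P.toOp * ∑ Q, h Q • Q.toOp).trace = 2 ^ n * h P := by
  simp only [Finset.mul_sum, Matrix.trace_sum, Matrix.mul_smul, Matrix.trace_smul,
    PauliString.trace_toOp_mul_toOp, smul_eq_mul, mul_ite, mul_zero, Finset.sum_ite_eq,
    Finset.mem_univ, if_true]
  ring

/-! ### The Pauli transfer matrix -/

/-- The entry `2⁻ⁿ tr(P U Q U†)` of the Pauli transfer matrix of `U`. The trace is real, so taking
its real part loses nothing. -/
def transfer (P Q : PauliString n) (U : UGroup n) : ℝ :=
  (P.toOp * ((U : Op n) * Q.toOp * star (U : Op n))).trace.re / 2 ^ n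

lemma coe_transfer (P Q : PauliString n) (U : UGroup n) :
    (transfer P Q U : ℂ) = (P.toOp * ((U : Op n) * Q.toOp * star (U : Op n))).trace / 2 ^ n := by
  have hreal : star (P.toOp * ((U : Op n) * Q.toOp * star (U : Op n))).trace
      = (P.toOp * ((U : Op n) * Q.toOp * star (U : Op n))).trace := by
    rw [← Matrix.trace_conjTranspose, ← Matrix.star_eq_conjTranspose, star_mul,
      (Q.isSelfAdjoint_toOp.conjugate (U : Op n)).star_eq, P.isSelfAdjoint_toOp.star_eq,
      Matrix.trace_mul_comm]
  rw [transfer]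
  push_cast
  rw [Complex.conj_eq_iff_re.mp hreal]

lemma continuous_transfer (P Q : PauliString n) : Continuous (transfer P Q) := by
  have hU : Continuous fun U : UGroup n => (U : Op n) := continuous_subtype_val
  exact (Complex.continuous_re.comp
    (continuous_const.matrix_mul ((hU.matrix_mul continuous_const).matrix_mul
      hU.star)).matrix_trace).div_const _

lemma transfer_eq_of_conj_eq {Q R : PauliString n} {U : UGroup n}
    (h : (U : Op n) * Q.toOp * star (U : Op n) = R.toOp) (P : PauliString n) :
    transfer P Q U = if P = R then 1 else 0 := by
  rw [← Complex.ofReal_inj, coe_transfer, h, PauliString.trace_toOp_mul_toOp]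
  split_ifs <;> simp

lemma transfer_one_right (P : PauliString n) (U : UGroup n) :
    transfer P (PauliString.one n) U = if P = PauliString.one n then 1 else 0 := by
  refine transfer_eq_of_conj_eq ?_ P
  rw [PauliString.toOp_one, mul_one, Unitary.mul_star_self_of_mem U.2]

lemma transfer_one_left (Q : PauliString n) (U : UGroup n) :
    transfer (PauliString.one n) Q U = if Q = PauliString.one n then 1 else 0 := by
  have htrace : ((U : Op n) * Q.toOp * star (U : Op n)).trace
      = (Q.toOp * (PauliString.one n).toOp).trace := by
    rw [Matrix.trace_mul_cycle, Unitary.star_mul_self_of_mem U.2, one_mul, PauliString.toOp_one,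
      mul_one]
  rw [← Complex.ofReal_inj, coe_transfer, PauliString.toOp_one, one_mul, htrace,
    PauliString.trace_toOp_mul_toOp]
  split_ifs <;> simp

/-! ### Partial swaps -/

/-- The permutation of pairs of bit strings that exchanges the two strings at the sites marked by
`w`. -/
def partialSwap (w : Bits n) : Equiv.Perm (Bits n × Bits n) :=
  Function.Involutive.toPerm
    (fun q => (fun i => if w i = 1 then q.2 i else q.1 i,
      fun i => if w i = 1 then q.1 i else q.2 i))
    fun q => by ext i <;> by_cases h : w i = 1 <;> simp [h]

lemma partialSwap_apply (w : Bits n) (q : Bits n × Bits n) :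
    partialSwap w q = (fun i => if w i = 1 then q.2 i else q.1 i,
      fun i => if w i = 1 then q.1 i else q.2 i) :=
  rfl

lemma partialSwap_symm (w : Bits n) : (partialSwap w).symm = partialSwap w :=
  Function.Involutive.toPerm_symm _

lemma partialSwap_zero : partialSwap (0 : Bits n) = 1 := by
  ext q <;> simp [partialSwap_apply]

/-- The operator that exchanges two copies of the sites marked by `w`. -/
def swapMatrix (w : Bits n) : Matrix (Bits n × Bits n) (Bits n × Bits n) ℂ :=
  (partialSwap w).permMatrix ℂ

lemma swapMatrix_mul_apply (w : Bits n) (M : Matrix (Bits n × Bits n) (Bits n × Bits n) ℂ)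
    (a b : Bits n × Bits n) : (swapMatrix w * M) a b = M (partialSwap w a) b := by
  rw [swapMatrix, Equiv.Perm.permMatrix, PEquiv.toMatrix_toPEquiv_mul, Matrix.submatrix_apply, id]

lemma mul_swapMatrix_apply (w : Bits n) (M : Matrix (Bits n × Bits n) (Bits n × Bits n) ℂ)
    (a b : Bits n × Bits n) : (M * swapMatrix w) a b = M a (partialSwap w b) := by
  rw [swapMatrix, Equiv.Perm.permMatrix, PEquiv.mul_toMatrix_toPEquiv, Matrix.submatrix_apply, id,
    partialSwap_symm]

lemma isSelfAdjoint_swapMatrix (w : Bits n) : IsSelfAdjoint (swapMatrix w) := by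
  rw [IsSelfAdjoint, Matrix.star_eq_conjTranspose, swapMatrix, Matrix.conjTranspose_permMatrix]
  exact congrArg (fun σ => Equiv.Perm.permMatrix ℂ σ) (partialSwap_symm w)

lemma swapMatrix_mul_self (w : Bits n) : swapMatrix w * swapMatrix w = 1 := by
  ext a b
  conv_lhs => rw [swapMatrix_mul_apply, ← one_mul (swapMatrix w), mul_swapMatrix_apply]
  simp [Matrix.one_apply]

/-- The number of marked sites. -/
def weight (w : Bits n) : ℕ := ∑ i, (w i : ℕ)

/-- The Pauli string is trivial outside the set marked by `w`. -/
def PauliString.Within (w : Bits n) (P : PauliString n) : Prop := ∀ i, w i = 0 → P i = .I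

instance instDecidablePredWithin (w : Bits n) : DecidablePred (PauliString.Within w) :=
  fun P => inferInstanceAs (Decidable (∀ i, w i = 0 → P i = .I))

lemma sum_within_toOp_mul_toOp (w : Bits n) (x y x' y' : Bits n) :
    ∑ P with PauliString.Within w P, P.toOp x y * P.toOp x' y' =
      if (y, y') = partialSwap w (x, x') then 2 ^ weight w else 0 := by
  have hprod (P : PauliString n) :
      (if PauliString.Within w P then P.toOp x y * P.toOp x' y' else 0) =
        ∏ i, if w i = 0 → P i = .I then (P i).mat (x i) (y i) * (P i).mat (x' i) (y' i) else 0 := by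
    rw [Finset.prod_ite_zero, Finset.prod_mul_distrib]
    by_cases hP : PauliString.Within w P
    · rw [if_pos hP, if_pos fun i _ => hP i, PauliString.toOp, Matrix.of_apply, Matrix.of_apply]
    · rw [if_neg hP, if_neg fun h => hP fun i => h i (Finset.mem_univ i)]
  have hsite (i : Fin n) : (∑ a : Pauli, if w i = 0 → a = Pauli.I then
      a.mat (x i) (y i) * a.mat (x' i) (y' i) else 0) =
      if y i = (partialSwap w (x, x')).1 i ∧ y' i = (partialSwap w (x, x')).2 i
        then (2 : ℂ) ^ (w i : ℕ) else 0 := by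
    obtain h | h : w i = 0 ∨ w i = 1 := by generalize w i = b; revert b; decide
    · simp only [h, forall_const, partialSwap_apply,
        Finset.sum_ite_eq' Finset.univ Pauli.I, Pauli.mat_I, Matrix.one_apply]
      split_ifs <;> simp_all
    · simp [h, partialSwap_apply, Pauli.sum_mat_mul_mat]
  rw [Finset.sum_filter, Finset.sum_congr rfl fun P _ => hprod P,
    sum_prod_eq_prod_sum fun i a => if w i = 0 → a = Pauli.I then
      a.mat (x i) (y i) * a.mat (x' i) (y' i) else 0]
  simp only [hsite, Finset.prod_ite_zero, Finset.prod_pow_eq_pow_sum]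
  simp [Prod.ext_iff, funext_iff, forall_and, weight]

lemma sum_within_kronecker (w : Bits n) :
    ∑ P with PauliString.Within w P, P.toOp ⊗ₖ P.toOp = (2 : ℂ) ^ weight w • swapMatrix w := by
  ext a b
  simp only [Matrix.sum_apply, Matrix.kroneckerMap_apply, sum_within_toOp_mul_toOp]
  simp [swapMatrix, Equiv.Perm.permMatrix, PEquiv.toMatrix_apply, eq_comm]

/-- The sum of the squared entries of the Pauli transfer matrix over the strings within `w`. -/
def transferSum (w : Bits n) (U : UGroup n) : ℝ :=
  ∑ P with PauliString.Within w P, ∑ Q with PauliString.Within w Q, transfer P Q U ^ 2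

lemma coe_transfer_sq (P Q : PauliString n) (U : UGroup n) :
    ((transfer P Q U ^ 2 : ℝ) : ℂ) = (P.toOp ⊗ₖ P.toOp * (((U : Op n) ⊗ₖ (U : Op n)) *
      (Q.toOp ⊗ₖ Q.toOp) * star ((U : Op n) ⊗ₖ (U : Op n)))).trace / 4 ^ n := by
  have hstar : star ((U : Op n) ⊗ₖ (U : Op n)) = star (U : Op n) ⊗ₖ star (U : Op n) :=
    Matrix.conjTranspose_kronecker _ _
  rw [Complex.ofReal_pow, coe_transfer, hstar, ← Matrix.mul_kronecker_mul,
    ← Matrix.mul_kronecker_mul, ← Matrix.mul_kronecker_mul, Matrix.trace_kronecker, div_pow,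
    ← pow_mul, mul_comm n 2, pow_mul]
  norm_num [sq]

lemma trace_swapMatrix_mul_conj (w : Bits n) (U : UGroup n) :
    (swapMatrix w * (((U : Op n) ⊗ₖ (U : Op n)) * swapMatrix w *
      star ((U : Op n) ⊗ₖ (U : Op n)))).trace =
      ((4 ^ n / 4 ^ weight w * transferSum w U : ℝ) : ℂ) := by
  have hw : (4 : ℂ) ^ weight w = 2 ^ weight w * 2 ^ weight w := by rw [← mul_pow]; norm_num
  have hsum : ((transferSum w U : ℝ) : ℂ) = 4 ^ weight w / 4 ^ n *
      (swapMatrix w * (((U : Op n) ⊗ₖ (U : Op n)) * swapMatrix w *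
        star ((U : Op n) ⊗ₖ (U : Op n)))).trace := by
    rw [transferSum]
    simp only [Complex.ofReal_sum, coe_transfer_sq, ← Finset.sum_div, ← Matrix.trace_sum,
      ← Finset.sum_mul, ← Finset.mul_sum, sum_within_kronecker, Matrix.smul_mul, Matrix.mul_smul,
      Matrix.trace_smul, smul_eq_mul, hw]
    ring
  push_cast
  rw [hsum]
  field_simp

lemma sum_norm_sq_eq_trace {m m' : Type*} [Fintype m] [Fintype m'] (M : Matrix m m' ℂ) :
    ((∑ i, ∑ j, ‖M i j‖ ^ 2 : ℝ) : ℂ) = (M * M.conjTranspose).trace := by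
  push_cast
  simp only [Matrix.trace, Matrix.diag, Matrix.mul_apply, Matrix.conjTranspose_apply]
  exact Finset.sum_congr rfl fun i _ => Finset.sum_congr rfl fun j _ =>
    (Complex.mul_conj' _).symm

lemma sum_norm_sq_commutator {m : Type*} [Fintype m] [DecidableEq m] {S V : Matrix m m ℂ}
    (hS : IsSelfAdjoint S) (hSS : S * S = 1) (hV : V * star V = 1) :
    ∑ i, ∑ j, ‖(S * V - V * S) i j‖ ^ 2 =
      2 * (Fintype.card m - (S * (V * S * star V)).trace.re) := by
  have hprod : (S * V - V * S) * star (S * V - V * S) =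
      1 + 1 - (S * (V * S * star V) + star (S * (V * S * star V))) := by
    have hSVVS : S * V * (star V * S) = 1 := by rw [← mul_assoc, mul_assoc S, hV, mul_one, hSS]
    have hVSSV : V * S * (S * star V) = 1 := by rw [← mul_assoc, mul_assoc V, hSS, mul_one, hV]
    simp only [star_sub, star_mul, star_star, hS.star_eq, sub_mul, mul_sub, hSVVS, hVSSV]
    noncomm_ring
  have hstar : (star (S * (V * S * star V))).trace = star (S * (V * S * star V)).trace :=
    Matrix.trace_conjTranspose _
  have hC := sum_norm_sq_eq_trace (S * V - V * S)
  rw [← Matrix.star_eq_conjTranspose, hprod, Matrix.trace_sub, Matrix.trace_add, Matrix.trace_add,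
    Matrix.trace_one, hstar] at hC
  have hre := congrArg Complex.re hC
  simp only [Complex.ofReal_re, Complex.sub_re, Complex.add_re, Complex.natCast_re,
    Complex.star_def, Complex.conj_re] at hre
  linarith

lemma sum_norm_sq_commutator_swapMatrix (w : Bits n) (U : UGroup n) :
    ∑ s, ∑ a, ‖(swapMatrix w * ((U : Op n) ⊗ₖ (U : Op n)) -
        ((U : Op n) ⊗ₖ (U : Op n)) * swapMatrix w) s a‖ ^ 2 =
      2 * 4 ^ n * (1 - (1 / 4) ^ weight w * transferSum w U) := by
  have hcard : (Fintype.card (Bits n × Bits n) : ℝ) = 4 ^ n := by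
    simp only [Fintype.card_prod, Fintype.card_fun, Fintype.card_fin]
    push_cast
    rw [← mul_pow]
    norm_num
  rw [sum_norm_sq_commutator (isSelfAdjoint_swapMatrix w) (swapMatrix_mul_self w)
    (Unitary.mul_star_self_of_mem (Matrix.kronecker_mem_unitary U.2 U.2)),
    trace_swapMatrix_mul_conj, Complex.ofReal_re, hcard, div_pow, one_pow]
  ring

lemma sum_toOp_mul_toOp (x y x' y' : Bits n) :
    ∑ P : PauliString n, P.toOp x y * P.toOp x' y' = if y = x' ∧ y' = x then 2 ^ n else 0 := by
  have hall (P : PauliString n) : PauliString.Within (fun _ => 1) P := fun i hi => by simp at hi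
  have hweight : weight (fun _ : Fin n => (1 : Fin 2)) = n := by simp [weight]
  simpa [hall, hweight, partialSwap_apply, Prod.ext_iff] using
    sum_within_toOp_mul_toOp (fun _ => 1) x y x' y'

lemma sum_trace_toOp_mul_sq (M : Op n) :
    ∑ P : PauliString n, (P.toOp * M).trace ^ 2 = 2 ^ n * (M * M).trace := by
  have hsq (P : PauliString n) : (P.toOp * M).trace ^ 2
      = ∑ x, ∑ y, ∑ x', ∑ y', (P.toOp x y * P.toOp x' y') * (M y x * M y' x') := by
    simp only [Matrix.trace, Matrix.diag, Matrix.mul_apply, sq, Finset.sum_mul, Finset.mul_sum]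
    refine Finset.sum_congr rfl fun x _ => Finset.sum_congr rfl fun y _ => ?_
    refine Finset.sum_congr rfl fun x' _ => Finset.sum_congr rfl fun y' _ => ?_
    ring
  simp only [hsq, Finset.sum_comm (s := (Finset.univ : Finset (PauliString n))),
    ← Finset.sum_mul, sum_toOp_mul_toOp, ite_and, ite_mul, zero_mul]
  simp only [Finset.sum_ite_irrel, Finset.sum_const_zero, Finset.sum_ite_eq, Finset.sum_ite_eq',
    Finset.mem_univ, if_true, Matrix.trace, Matrix.diag, Matrix.mul_apply, Finset.mul_sum]
  exact Finset.sum_comm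

lemma sum_transfer_sq (Q : PauliString n) (U : UGroup n) :
    ∑ P : PauliString n, transfer P Q U ^ 2 = 1 := by
  have hsq : (U : Op n) * Q.toOp * star (U : Op n) * ((U : Op n) * Q.toOp * star (U : Op n)) = 1 :=
    calc _ = (U : Op n) * Q.toOp * (star (U : Op n) * (U : Op n)) * Q.toOp * star (U : Op n) := by
          simp only [mul_assoc]
      _ = (U : Op n) * (Q.toOp * Q.toOp) * star (U : Op n) := by
          rw [Unitary.star_mul_self_of_mem U.2, mul_one, mul_assoc (U : Op n)]
      _ = 1 := by rw [PauliString.toOp_mul_self, mul_one, Unitary.mul_star_self_of_mem U.2]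
  rw [← Complex.ofReal_inj]
  push_cast
  simp only [coe_transfer, div_pow, ← Finset.sum_div, sum_trace_toOp_mul_sq, hsq,
    Matrix.trace_one, Fintype.card_fun, Fintype.card_fin]
  push_cast
  field_simp

/-! ### Haar averages -/

instance instIsProbabilityMeasureHaar (n : ℕ) : IsProbabilityMeasure (haar n) :=
  ⟨by simpa [haar] using
    Measure.haarMeasure_self (K₀ := (⊤ : TopologicalSpace.PositiveCompacts (UGroup n)))⟩

instance instIsMulLeftInvariantHaar (n : ℕ) : (haar n).IsMulLeftInvariant := by
  unfold haar
  infer_instance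

/-- `W = (A + B) / √2` does it. -/
lemma exists_unitary_conj_eq_of_anticommute {R : Type*} [Ring R] [StarRing R] [Algebra ℝ R]
    [StarModule ℝ R] {A B : R} (hA : IsSelfAdjoint A) (hB : IsSelfAdjoint B) (hAA : A * A = 1)
    (hBB : B * B = 1) (hAB : A * B = -(B * A)) :
    ∃ W : unitary R, star (W : R) * A * (W : R) = B := by
  set c : ℝ := (√2)⁻¹
  have hcc : c * c = 2⁻¹ := by
    rw [← mul_inv, Real.mul_self_sqrt zero_le_two]
  have hsq : (A + B) * (A + B) = (2 : ℝ) • (1 : R) := by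
    rw [add_mul, mul_add, mul_add, hAA, hBB, hAB, two_smul]
    abel
  have hconj : (A + B) * A * (A + B) = (2 : ℝ) • B := by
    have hBAA : B * A * A = B := by rw [mul_assoc, hAA, mul_one]
    have hBAB : B * A * B = -A := by rw [mul_assoc, hAB, mul_neg, ← mul_assoc, hBB, one_mul]
    rw [add_mul, hAA, add_mul, one_mul, mul_add, hBAA, hBAB, two_smul]
    abel
  have hW : star (c • (A + B)) = c • (A + B) := by
    rw [star_smul, star_add, hA.star_eq, hB.star_eq, star_trivial]
  have hWW : c • (A + B) * (c • (A + B)) = 1 := by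
    rw [smul_mul_smul_comm, hsq, hcc, smul_smul, inv_mul_cancel₀ two_ne_zero, one_smul]
  refine ⟨⟨c • (A + B), Unitary.mem_iff.mpr ⟨by rw [hW, hWW], by rw [hW, hWW]⟩⟩, ?_⟩
  change star (c • (A + B)) * A * (c • (A + B)) = B
  rw [hW, smul_mul_assoc, smul_mul_smul_comm, hcc, hconj, smul_smul,
    inv_mul_cancel₀ two_ne_zero, one_smul]

lemma transfer_mul_left {P R : PauliString n} {W : UGroup n}
    (h : star (W : Op n) * P.toOp * (W : Op n) = R.toOp) (Q : PauliString n) (U : UGroup n) :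
    transfer P Q (W * U) = transfer R Q U := by
  rw [transfer, transfer, ← h, Submonoid.coe_mul, star_mul, ← mul_assoc _ (star (U : Op n)),
    ← mul_assoc P.toOp, Matrix.trace_mul_comm _ (star (W : Op n))]
  simp only [mul_assoc]

lemma integral_transfer_sq_eq {P R : PauliString n} (h : P.sign R = -1) (Q : PauliString n) :
    ∫ U, transfer P Q U ^ 2 ∂(haar n) = ∫ U, transfer R Q U ^ 2 ∂(haar n) := by
  obtain ⟨W, hW⟩ := exists_unitary_conj_eq_of_anticommute P.isSelfAdjoint_toOp R.isSelfAdjoint_toOp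
    P.toOp_mul_self R.toOp_mul_self (by simp [PauliString.toOp_mul_comm P R, h])
  rw [← integral_mul_left_eq_self (fun U => transfer P Q U ^ 2) W]
  simp only [transfer_mul_left hW]

/-- Half of all strings anticommute with `P`, and they all have the same Haar average as `P`. -/
lemma integral_transfer_sq_le {P : PauliString n} (hP : P ≠ PauliString.one n)
    (Q : PauliString n) : ∫ U, transfer P Q U ^ 2 ∂(haar n) ≤ 2 / 4 ^ n := by
  set e : PauliString n → ℝ := fun R => ∫ U, transfer R Q U ^ 2 ∂(haar n)
  have hle (R : PauliString n) : (1 - P.sign R) * e P ≤ 2 * e R := by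
    have he : 0 ≤ e R := integral_nonneg fun U => sq_nonneg _
    rcases P.sign_eq_one_or R with h | h
    · simpa [h] using he
    · have : e P = e R := integral_transfer_sq_eq h Q
      norm_num [h, this]
  have hsum : ∑ R, e R = 1 := by
    have hint (R : PauliString n) : Integrable (fun U => transfer R Q U ^ 2) (haar n) :=
      ((continuous_transfer R Q).pow 2).integrable_of_hasCompactSupport (.of_compactSpace _)
    rw [← integral_finsetSum _ fun R _ => hint R]
    simp [sum_transfer_sq]
  have hsign : ∑ R, ((1 : ℝ) - P.sign R) = 4 ^ n := by
    rw [Finset.sum_sub_distrib, ← Int.cast_sum, PauliString.sum_sign hP, Int.cast_zero, sub_zero,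
      Finset.sum_const, Finset.card_univ, Fintype.card_fun, Fintype.card_fin, nsmul_one]
    exact_mod_cast rfl
  rw [le_div_iff₀' (by positivity)]
  calc 4 ^ n * e P = ∑ R, (1 - P.sign R) * e P := by rw [← Finset.sum_mul, hsign]
    _ ≤ ∑ R, 2 * e R := Finset.sum_le_sum fun R _ => hle R
    _ = 2 := by rw [← Finset.mul_sum, hsum, mul_one]

/-! ### Time evolutions of Pauli sums -/

lemma evolution_conj_of_commute {X : Op n} {H : Hamiltonian n} (h : Commute X (H : Op n)) (t : ℝ) :
    (evolution (H, t) : Op n) * X * star (evolution (H, t) : Op n) = X := by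
  have hcomm : Commute X (evolution (H, t) : Op n) := Commute.exp_right (h.smul_right _)
  rw [← hcomm.eq, mul_assoc, Unitary.mul_star_self_of_mem (evolution (H, t)).2, mul_one]

lemma measurable_evolution (n : ℕ) : Measurable (evolution (n := n)) := by
  -- Any Banach algebra norm on the matrices will do; it induces the product topology.
  let _ : NormedRing (Op n) := Matrix.linftyOpNormedRing
  let _ : NormedAlgebra ℂ (Op n) := Matrix.linftyOpNormedAlgebra
  let _ : NormedAlgebra ℚ (Op n) := NormedAlgebra.restrictScalars ℚ ℂ (Op n)
  have htime : Continuous fun p : Hamiltonian n × ℝ => -(Complex.I * (p.2 : ℂ)) := by fun_prop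
  have hop : Continuous fun p : Hamiltonian n × ℝ => (p.1 : Op n) :=
    continuous_subtype_val.comp continuous_fst
  have hexp : Continuous (evolution (n := n)) :=
    ((NormedSpace.exp_continuous (𝔸 := Op n)).comp (htime.smul hop)).subtype_mk _
  exact hexp.measurable

instance instIsProbabilityMeasureEvolutionEnsemble (D : Measure (Hamiltonian n × ℝ))
    [IsProbabilityMeasure D] : IsProbabilityMeasure (evolutionEnsemble D) :=
  Measure.isProbabilityMeasure_map (measurable_evolution n).aemeasurable

lemma sum_transfer_mul_coeff {H : Hamiltonian n} {h : PauliString n → ℝ}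
    (hH : (H : Op n) = ∑ P, (h P : ℂ) • PauliString.toOp P) (t : ℝ) (P : PauliString n) :
    ∑ Q, transfer P Q (evolution (H, t)) * h Q = h P := by
  have hconj : (2 : ℂ) ^ n * h P = (P.toOp * ((evolution (H, t) : Op n) * (H : Op n) *
      star (evolution (H, t) : Op n))).trace := by
    rw [evolution_conj_of_commute (Commute.refl _), hH,
      PauliString.trace_toOp_mul_sum fun Q => (h Q : ℂ)]
  rw [← Complex.ofReal_inj, ← mul_right_inj' (pow_ne_zero n (two_ne_zero' ℂ)), hconj, hH]
  push_cast
  simp only [coe_transfer, Finset.mul_sum, Finset.sum_mul, Matrix.trace_sum, Matrix.mul_smul,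
    Matrix.smul_mul, Matrix.trace_smul, smul_eq_mul]
  refine Finset.sum_congr rfl fun Q _ => ?_
  field_simp

lemma one_le_sum_sq_of_fixed_vector {ι : Type*} {S : Finset ι} {M : ι → ι → ℝ} {v : ι → ℝ}
    (hfix : ∀ i ∈ S, ∑ j ∈ S, M i j * v j = v i) (hv : ∃ i ∈ S, v i ≠ 0) :
    1 ≤ ∑ i ∈ S, ∑ j ∈ S, M i j ^ 2 := by
  obtain ⟨i, hi, hvi⟩ := hv
  have hpos : 0 < ∑ i ∈ S, v i ^ 2 :=
    Finset.sum_pos' (fun _ _ => sq_nonneg _) ⟨i, hi, by positivity⟩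
  refine le_of_mul_le_mul_right ?_ hpos
  calc 1 * ∑ i ∈ S, v i ^ 2 = ∑ i ∈ S, (∑ j ∈ S, M i j * v j) ^ 2 := by
        rw [one_mul]
        exact Finset.sum_congr rfl fun i hi => by rw [hfix i hi]
    _ ≤ ∑ i ∈ S, (∑ j ∈ S, M i j ^ 2) * ∑ j ∈ S, v j ^ 2 :=
        Finset.sum_le_sum fun i _ => Finset.sum_mul_sq_le_sq_mul_sq S _ _
    _ = _ := (Finset.sum_mul _ _ _).symm

/-- The coefficient vector of `H` is a fixed vector of the transfer matrix of `e^{-iHt}`; if it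
vanishes on `S` then `H` is a scalar and the transfer matrix is the identity. -/
lemma one_le_sum_transfer_sq {S : Finset (PauliString n)} (hne : S.Nonempty)
    (hS : PauliString.one n ∉ S) {H : Hamiltonian n}
    (hH : IsPauliSum (fun P => P = PauliString.one n ∨ P ∈ S) H) (t : ℝ) :
    1 ≤ ∑ P ∈ S, ∑ Q ∈ S, transfer P Q (evolution (H, t)) ^ 2 := by
  obtain ⟨h, hsupp, hH⟩ := hH
  have hzero {P : PauliString n} (h1 : P ≠ PauliString.one n) (hP : P ∉ S) : h P = 0 := by
    by_contra hne
    exact (hsupp P hne).elim h1 hP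
  by_cases h0 : ∀ P ∈ S, h P = 0
  · have hscalar : (H : Op n) = (h (PauliString.one n) : ℂ) • 1 := by
      rw [hH, Finset.sum_eq_single (PauliString.one n) (fun P _ h1 => ?_) (by simp),
        PauliString.toOp_one]
      by_cases hP : P ∈ S
      · simp [h0 P hP]
      · simp [hzero h1 hP]
    have hid (R P : PauliString n) : transfer R P (evolution (H, t)) = if R = P then 1 else 0 := by
      refine transfer_eq_of_conj_eq (evolution_conj_of_commute ?_ t) R
      rw [hscalar]
      exact (Commute.one_right _).smul_right _
    obtain ⟨P, hP⟩ := hne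
    exact one_le_sum_sq_of_fixed_vector (v := Pi.single P 1)
      (fun R _ => by simp [Pi.single_apply, hP, hid]) ⟨P, hP, by simp⟩
  · push Not at h0
    refine one_le_sum_sq_of_fixed_vector (fun P hP => ?_) h0
    rw [← sum_transfer_mul_coeff hH t P]
    refine Finset.sum_subset (Finset.subset_univ S) fun Q _ hQ => ?_
    by_cases hQ1 : Q = PauliString.one n
    · rw [hQ1, transfer_one_right, if_neg (ne_of_mem_of_not_mem hP hS), zero_mul]
    · rw [hzero hQ1 hQ, mul_zero]

/-! ### Random marks -/

/-- The mark of the preceding site. -/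
def prevMark (w : Bits n) (i : Fin n) : Fin 2 := (Fin.cons 0 w : Fin (n + 1) → Fin 2) i.castSucc

lemma eq_of_forall_step_prevMark {f : Fin n → Fin 2 → Fin 2} {w w' : Bits n}
    (hw : ∀ i, f i (prevMark w i) = w i) (hw' : ∀ i, f i (prevMark w' i) = w' i) : w = w' := by
  have hcons (i : Fin (n + 1)) :
      (Fin.cons 0 w : Fin (n + 1) → Fin 2) i = (Fin.cons 0 w' : Fin (n + 1) → Fin 2) i := by
    induction i using Fin.induction with
    | zero => rfl
    | succ i ih => rw [Fin.cons_succ, Fin.cons_succ, ← hw i, ← hw' i, prevMark, ih, prevMark]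
  funext i
  simpa using hcons i.succ

/-- The mark of a site, given its coins `s` and the mark `a` of the preceding site: a run of marks
starts if the coins `s 3, s 4, …` are all `1`, and continues if the coin `s 0` is `1` (the two
conditions combined by an exclusive or). -/
def markStep (s : Bits (k + 3)) (a : Fin 2) : Fin 2 :=
  (∏ j : Fin k, s j.succ.succ.succ) + s 0 * a

/-- The transition probabilities of the Markov chain of marks. -/
def transition (k : ℕ) (a b : Fin 2) : ℝ :=
  if a = 1 then 1 / 2 else if b = 1 then (1 / 2) ^ k else 1 - (1 / 2) ^ k

lemma transition_nonneg (k : ℕ) (a b : Fin 2) : 0 ≤ transition k a b := by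
  have hle : ((1 : ℝ) / 2) ^ k ≤ 1 := pow_le_one₀ (by norm_num) (by norm_num)
  unfold transition
  split_ifs
  · norm_num
  · positivity
  · linarith

/-- The probability that `w` is the set of marked sites. -/
def markProb (k : ℕ) (w : Bits n) : ℝ := ∏ i, transition k (prevMark w i) (w i)

lemma markProb_nonneg (k : ℕ) (w : Bits n) : 0 ≤ markProb k w :=
  Finset.prod_nonneg fun _ _ => transition_nonneg _ _ _

lemma sum_bits_succ {M : Type*} [AddCommMonoid M] (f : Bits (n + 1) → M) :
    ∑ s, f s = ∑ b : Fin 2, ∑ s : Bits n, f (Fin.cons b s) := by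
  rw [← (Fin.consEquiv fun _ : Fin (n + 1) => Fin 2).sum_comp, Fintype.sum_prod_type]
  rfl

lemma sum_bits_prod (k : ℕ) (f : Fin 2 → ℝ) :
    ∑ r : Bits k, f (∏ j, r j) = f 1 + (2 ^ k - 1) * f 0 := by
  induction k with
  | zero => simp
  | succ k ih =>
    simp only [sum_bits_succ, Fin.prod_univ_succ, Fin.cons_zero, Fin.cons_succ, Fin.sum_univ_two,
      zero_mul, one_mul, ih, Finset.sum_const, Finset.card_univ, Fintype.card_fun,
      Fintype.card_fin, nsmul_eq_mul]
    push_cast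
    ring

lemma sum_markStep (k : ℕ) (a b x y : Fin 2) :
    ∑ s : Bits (k + 3), (if markStep s a = b ∧ s 1 = x ∧ s 2 = y then (1 : ℝ) else 0) =
      2 ^ (k + 1) * transition k a b := by
  have hr (c : Fin 2) : ∑ r : Bits k, (if (∏ j, r j) + c * a = b then (1 : ℝ) else 0) =
      (if 1 + c * a = b then 1 else 0) + (2 ^ k - 1) * if 0 + c * a = b then 1 else 0 :=
    sum_bits_prod k fun u => if u + c * a = b then 1 else 0
  have hinv : (2 : ℝ) ^ k * ((2 : ℝ) ^ k)⁻¹ = 1 := mul_inv_cancel₀ (by positivity)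
  have hone (c x' y' : Fin 2) (r : Bits k) :
      (Fin.cons c (Fin.cons x' (Fin.cons y' r : Bits (k + 1)) : Bits (k + 2)) : Bits (k + 3)) 1
        = x' := rfl
  have htwo (c x' y' : Fin 2) (r : Bits k) :
      (Fin.cons c (Fin.cons x' (Fin.cons y' r : Bits (k + 1)) : Bits (k + 2)) : Bits (k + 3)) 2
        = y' := rfl
  have hcollapse (c : Fin 2) : ∑ x' : Fin 2, ∑ y' : Fin 2, ∑ r : Bits k,
      (if (∏ j, r j) + c * a = b ∧ x' = x ∧ y' = y then (1 : ℝ) else 0) =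
        ∑ r : Bits k, if (∏ j, r j) + c * a = b then 1 else 0 := by
    rw [Fintype.sum_eq_single x fun x' hx => by simp [hx],
      Fintype.sum_eq_single y fun y' hy => by simp [hy]]
    simp only [and_true]
  simp only [sum_bits_succ, markStep, Fin.cons_zero, Fin.cons_succ, hone, htwo, hcollapse]
  rw [Fin.sum_univ_two, hr, hr]
  fin_cases a <;> fin_cases b <;> simp [transition, pow_succ] <;> nlinarith [hinv]

lemma sum_coins_eq_sum_marks {w : (Fin n → Bits (k + 3)) → Bits n}
    (hw : ∀ ρ i, markStep (ρ i) (prevMark (w ρ) i) = w ρ i)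
    (G : Bits n → Bits n × Bits n → ℝ) :
    ∑ ρ, G (w ρ) (fun i => ρ i 1, fun i => ρ i 2) =
      (2 ^ (k + 1)) ^ n * ∑ v, markProb k v * ∑ a, G v a := by
  have hind (ρ : Fin n → Bits (k + 3)) (v : Bits n) (a : Bits n × Bits n) :
      (if v = w ρ ∧ a = (fun i => ρ i 1, fun i => ρ i 2) then (1 : ℝ) else 0) =
        ∏ i, if markStep (ρ i) (prevMark v i) = v i ∧ ρ i 1 = a.1 i ∧ ρ i 2 = a.2 i
          then 1 else 0 := by
    have hv : v = w ρ ↔ ∀ i, markStep (ρ i) (prevMark v i) = v i :=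
      ⟨fun h => h ▸ hw ρ, fun h => eq_of_forall_step_prevMark h (hw ρ)⟩
    rw [Finset.prod_ite_zero]
    simp [hv, forall_and, Prod.ext_iff, funext_iff, eq_comm]
  have hcount (v : Bits n) (a : Bits n × Bits n) :
      ∑ ρ, (if v = w ρ ∧ a = (fun i => ρ i 1, fun i => ρ i 2) then (1 : ℝ) else 0) =
        (2 ^ (k + 1)) ^ n * markProb k v := by
    simp only [hind]
    rw [sum_prod_eq_prod_sum fun i s => if markStep s (prevMark v i) = v i ∧ s 1 = a.1 i ∧
      s 2 = a.2 i then (1 : ℝ) else 0]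
    simp only [sum_markStep, Finset.prod_mul_distrib, Finset.prod_const, Finset.card_univ,
      Fintype.card_fin, markProb]
  calc ∑ ρ, G (w ρ) (fun i => ρ i 1, fun i => ρ i 2)
      = ∑ ρ, ∑ v, ∑ a, (if v = w ρ ∧ a = (fun i => ρ i 1, fun i => ρ i 2) then 1 else 0) *
          G v a := by
        refine Finset.sum_congr rfl fun ρ _ => ?_
        simp [ite_and]
    _ = ∑ v, ∑ a, (2 ^ (k + 1)) ^ n * markProb k v * G v a := by
        rw [Finset.sum_comm]
        refine Finset.sum_congr rfl fun v _ => ?_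
        rw [Finset.sum_comm]
        exact Finset.sum_congr rfl fun a _ => by rw [← hcount v a, Finset.sum_mul]
    _ = _ := by simp only [Finset.mul_sum, mul_assoc]

lemma sum_chain_le {f : Fin 2 → Fin 2 → ℝ} {B : ℝ} (hf : ∀ a b, 0 ≤ f a b)
    (hB : ∀ a, f a 0 + f a 1 ≤ B) (n : ℕ) (a : Fin 2) :
    ∑ w : Bits n, ∏ i, f ((Fin.cons a w : Fin (n + 1) → Fin 2) i.castSucc) (w i) ≤ B ^ n := by
  have hB0 : 0 ≤ B := (add_nonneg (hf 0 0) (hf 0 1)).trans (hB 0)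
  induction n generalizing a with
  | zero => simp
  | succ n ih =>
    simp only [sum_bits_succ, Fin.prod_univ_succ, Fin.castSucc_zero, Fin.cons_zero,
      Fin.cons_succ, ← Fin.succ_castSucc, ← Finset.mul_sum]
    calc _ ≤ ∑ b, f a b * B ^ n :=
          Finset.sum_le_sum fun b _ => mul_le_mul_of_nonneg_left (ih b) (hf a b)
      _ = (f a 0 + f a 1) * B ^ n := by rw [Fin.sum_univ_two, add_mul]
      _ ≤ B * B ^ n := mul_le_mul_of_nonneg_right (hB a) (pow_nonneg hB0 n)
      _ = B ^ (n + 1) := (pow_succ' B n).symm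

lemma sum_markProb_mul_four_pow_le (hk : 1 ≤ k) :
    ∑ w : Bits n, markProb k w * 4 ^ weight w ≤ (5 / 2) ^ n := by
  have hk' : ((1 : ℝ) / 2) ^ k ≤ 1 / 2 :=
    pow_le_of_le_one (by norm_num) (by norm_num) (by omega)
  have hstep (a : Fin 2) :
      transition k a 0 * 4 ^ ((0 : Fin 2) : ℕ) + transition k a 1 * 4 ^ ((1 : Fin 2) : ℕ) ≤
        5 / 2 := by
    fin_cases a
    · norm_num [transition] at hk' ⊢
      linarith
    · norm_num [transition]
  refine le_trans (le_of_eq ?_) (sum_chain_le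
    (f := fun a b => transition k a b * 4 ^ (b : ℕ))
    (fun a b => mul_nonneg (transition_nonneg _ _ _) (by positivity)) hstep n 0)
  refine Finset.sum_congr rfl fun w _ => ?_
  rw [Finset.prod_mul_distrib, Finset.prod_pow_eq_pow_sum]
  rfl

/-- The number of runs of marked sites. -/
def runs (w : Bits n) : ℕ := (Finset.univ.filter fun i => w i = 1 ∧ prevMark w i = 0).card

lemma sum_prevMark_le (w : Bits n) : ∑ i, (prevMark w i : ℕ) ≤ weight w := by
  have hsum : ∑ i : Fin (n + 1), ((Fin.cons 0 w : Fin (n + 1) → Fin 2) i : ℕ) = weight w := by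
    simp [Fin.sum_univ_succ, weight]
  rw [Fin.sum_univ_castSucc] at hsum
  exact Nat.le.intro hsum

lemma le_transition (k : ℕ) (a b : Fin 2) :
    (1 - (1 / 2) ^ k) * ((1 / 2) ^ (b : ℕ) * (1 / 2) ^ (a : ℕ) *
      if b = 1 ∧ a = 0 then (1 / 2) ^ k else 1) ≤ transition k a b := by
  have hpos : (0 : ℝ) ≤ (1 / 2) ^ k := by positivity
  have hle : ((1 : ℝ) / 2) ^ k ≤ 1 := pow_le_one₀ (by norm_num) (by norm_num)
  unfold transition
  generalize ((1 : ℝ) / 2) ^ k = s at *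
  fin_cases a <;> fin_cases b <;> simp <;> nlinarith

lemma le_markProb (k : ℕ) (w : Bits n) :
    (1 - (1 / 2) ^ k) ^ n * (1 / 4) ^ weight w * ((1 / 2) ^ k) ^ runs w ≤ markProb k w := by
  have hle : ((1 : ℝ) / 2) ^ k ≤ 1 := pow_le_one₀ (by norm_num) (by norm_num)
  have hpow : ((1 : ℝ) / 4) ^ weight w ≤
      (1 / 2) ^ weight w * (1 / 2) ^ ∑ i, (prevMark w i : ℕ) :=
    calc ((1 : ℝ) / 4) ^ weight w = (1 / 2) ^ weight w * (1 / 2) ^ weight w := by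
          rw [← mul_pow]; norm_num
      _ ≤ _ := by
          gcongr ?_ * ?_
          exact pow_le_pow_of_le_one (by norm_num) (by norm_num) (sum_prevMark_le w)
  calc (1 - (1 / 2) ^ k) ^ n * (1 / 4) ^ weight w * ((1 / 2) ^ k) ^ runs w
      ≤ (1 - (1 / 2) ^ k) ^ n * ((1 / 2) ^ weight w * (1 / 2) ^ ∑ i, (prevMark w i : ℕ)) *
        ((1 / 2) ^ k) ^ runs w := by gcongr
    _ = ∏ i, ((1 - (1 / 2 : ℝ) ^ k) * ((1 / 2) ^ (w i : ℕ) * (1 / 2) ^ (prevMark w i : ℕ) *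
        if w i = 1 ∧ prevMark w i = 0 then (1 / 2) ^ k else 1)) := by
      simp only [Finset.prod_mul_distrib, Finset.prod_pow_eq_pow_sum, Finset.prod_const,
        ← Finset.prod_filter, Finset.card_univ, Fintype.card_fin, Finset.sum_const, smul_eq_mul,
        weight, runs, mul_assoc]
      rw [← pow_mul, mul_comm k]
    _ ≤ markProb k w := by
      refine Finset.prod_le_prod (fun i _ => mul_nonneg (sub_nonneg.mpr hle) ?_) fun i _ =>
        le_transition k _ _
      split_ifs <;> positivity

/-- The number of coins that decide whether a run of marks starts. With about `log₂ n` coins, runs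
are rare but still start with probability of order `1 / n`. -/
def coinCount (n : ℕ) : ℕ := Nat.clog 2 n + 1

lemma half_pow_coinCount_le (hn : 1 ≤ n) : ((1 : ℝ) / 2) ^ coinCount n ≤ 1 / (2 * n) := by
  have hclog : (n : ℝ) ≤ 2 ^ Nat.clog 2 n := by exact_mod_cast Nat.le_pow_clog one_lt_two n
  have : (0 : ℝ) < n := by exact_mod_cast hn
  rw [coinCount, pow_succ', div_pow, one_pow, div_mul_div_comm, one_mul]
  gcongr

lemma le_half_pow_coinCount (hn : 2 ≤ n) : 1 / (4 * (n : ℝ)) ≤ (1 / 2) ^ coinCount n := by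
  have hclog : 2 ^ (Nat.clog 2 n).pred < n := Nat.pow_pred_clog_lt_self one_lt_two (by omega)
  have hpos : 0 < Nat.clog 2 n := Nat.clog_pos one_lt_two hn
  have hcount : coinCount n = (Nat.clog 2 n).pred + 2 := by
    rw [coinCount, Nat.pred_eq_sub_one]; omega
  have hpow : 2 ^ coinCount n ≤ 4 * n := by rw [hcount, pow_add]; omega
  rw [div_pow, one_pow]
  gcongr
  exact_mod_cast hpow

lemma half_le_one_sub_half_pow_coinCount_pow (hn : 1 ≤ n) :
    (1 : ℝ) / 2 ≤ (1 - (1 / 2) ^ coinCount n) ^ n := by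
  have hn' : (1 : ℝ) ≤ n := by exact_mod_cast hn
  have hle : 1 / (2 * (n : ℝ)) ≤ 1 := by rw [div_le_one (by positivity)]; linarith
  calc (1 : ℝ) / 2 = 1 + n * -(1 / (2 * (n : ℝ))) := by field_simp; norm_num
    _ ≤ (1 + -(1 / (2 * (n : ℝ)))) ^ n := one_add_mul_le_pow (by linarith) n
    _ ≤ (1 - (1 / 2) ^ coinCount n) ^ n :=
      pow_le_pow_left₀ (by linarith) (by linarith [half_pow_coinCount_le hn]) n

lemma le_markProb_coinCount (hn : 2 ≤ n) (w : Bits n) {a b : ℕ} (ha : weight w ≤ a)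
    (hb : runs w ≤ b) :
    1 / 2 * (1 / 16) ^ a * (1 / (4 * (n : ℝ))) ^ b ≤
      markProb (coinCount n) w * (1 / 4) ^ weight w := by
  have hn' : (2 : ℝ) ≤ n := by exact_mod_cast hn
  have hruns : (1 / (4 * (n : ℝ))) ^ b ≤ ((1 / 2) ^ coinCount n) ^ runs w :=
    calc (1 / (4 * (n : ℝ))) ^ b ≤ (1 / (4 * (n : ℝ))) ^ runs w :=
          pow_le_pow_of_le_one (by positivity) (by rw [div_le_one] <;> linarith) hb
      _ ≤ _ := pow_le_pow_left₀ (by positivity) (le_half_pow_coinCount hn) _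
  have hweight : ((1 : ℝ) / 16) ^ a ≤ (1 / 4) ^ weight w * (1 / 4) ^ weight w :=
    calc ((1 : ℝ) / 16) ^ a ≤ (1 / 16) ^ weight w :=
          pow_le_pow_of_le_one (by norm_num) (by norm_num) ha
      _ = _ := by rw [← mul_pow]; norm_num
  calc 1 / 2 * (1 / 16) ^ a * (1 / (4 * (n : ℝ))) ^ b
      ≤ (1 - (1 / 2) ^ coinCount n) ^ n * ((1 / 4) ^ weight w * (1 / 4) ^ weight w) *
        ((1 / 2) ^ coinCount n) ^ runs w := by
        have hhalf := half_le_one_sub_half_pow_coinCount_pow (one_le_two.trans hn)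
        gcongr ?_ * ?_ * ?_
    _ = ((1 - (1 / 2) ^ coinCount n) ^ n * (1 / 4) ^ weight w *
        ((1 / 2) ^ coinCount n) ^ runs w) * (1 / 4) ^ weight w := by ring
    _ ≤ _ := by gcongr; exact le_markProb _ w

/-! ### Gates on basis states -/

/-- The computational basis states. -/
def ket (z : Bits m) : Bits m → ℂ := Pi.single z 1

lemma ket_apply (z x : Bits m) : ket z x = if x = z then 1 else 0 := by
  simp [ket, Pi.single_apply]

lemma onWires_mulVec_ket {l : ℕ} (e : Fin l ↪ Fin m) (A : Op l) (z : Bits m) :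
    (onWires e A).mulVec (ket z) = ∑ a, A a (z ∘ e) • ket (Function.extend e a z) := by
  have hextend (x : Bits m) (a : Bits l) :
      x = Function.extend e a z ↔ a = x ∘ e ∧ ∀ j ∉ Set.range e, x j = z j := by
    constructor
    · rintro rfl
      exact ⟨(Function.extend_comp e.injective a z).symm, fun j hj =>
        Function.extend_apply' _ _ _ hj⟩
    · rintro ⟨rfl, hx⟩
      funext j
      by_cases hj : j ∈ Set.range e
      · obtain ⟨i, rfl⟩ := hj
        exact (e.injective.extend_apply (x ∘ e) z i).symm
      · rw [hx j hj, Function.extend_apply' _ _ _ hj]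
  funext x
  simp only [ket, Matrix.mulVec_single_one, Finset.sum_apply, Matrix.col_apply, Pi.smul_apply,
    smul_eq_mul, Pi.single_apply, hextend, onWires, Matrix.of_apply]
  simp_rw [mul_ite, mul_one, mul_zero]
  by_cases h : ∀ j ∉ Set.range e, x j = z j
  · simp_rw [if_pos h, and_iff_left h]
    rw [Finset.sum_ite_eq' Finset.univ, if_pos (Finset.mem_univ _)]
  · simp_rw [if_neg h, and_iff_right_of_imp fun h' => absurd h' h, if_neg h, Finset.sum_const_zero]

lemma onWires_mulVec_ket_eq_ket {l : ℕ} {e : Fin l ↪ Fin m} {A : Op l} {z z' : Bits m}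
    (hA : ∀ a, A a (z ∘ e) = if a = z' ∘ e then 1 else 0)
    (hz : ∀ j ∉ Set.range e, z' j = z j) : (onWires e A).mulVec (ket z) = ket z' := by
  have hextend : Function.extend e (z' ∘ e) z = z' := by
    funext j
    by_cases hj : j ∈ Set.range e
    · obtain ⟨i, rfl⟩ := hj
      exact e.injective.extend_apply _ _ i
    · rw [hz j hj, Function.extend_apply' _ _ _ hj]
  simp [onWires_mulVec_ket, hA, hextend]

/-- The operator applied by a list of operations, of which the first one acts first. -/
def gatesOp (U : UGroup n) (gs : List (Gate n m)) : Op m := (gs.map (Gate.op U)).reverse.prod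

lemma gatesOp_nil (U : UGroup n) : gatesOp U ([] : List (Gate n m)) = 1 := rfl

lemma gatesOp_append (U : UGroup n) (gs gs' : List (Gate n m)) :
    gatesOp U (gs ++ gs') = gatesOp U gs' * gatesOp U gs := by
  simp [gatesOp]

lemma gatesOp_cons (U : UGroup n) (g : Gate n m) (gs : List (Gate n m)) :
    gatesOp U (g :: gs) = gatesOp U gs * g.op U := by
  simp [gatesOp]

lemma foldl_mulVec_eq_gatesOp_mulVec (U : UGroup n) (gs : List (Gate n m)) (ψ : Bits m → ℂ) :
    gs.foldl (fun ψ g => (g.op U).mulVec ψ) ψ = (gatesOp U gs).mulVec ψ := by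
  induction gs generalizing ψ with
  | nil => simp [gatesOp_nil]
  | cons g gs ih => rw [List.foldl_cons, ih, gatesOp_cons, Matrix.mulVec_mulVec]

lemma sum_accept {ι : Type*} [Fintype ι] {z : ι → Bits m} (hz : Function.Injective z) (α : ι → ℂ)
    (o : Fin m) :
    (∑ x : Bits m, if x o = 1 then ‖(∑ i, α i • ket (z i)) x‖ ^ 2 else 0) =
      ∑ i, if z i o = 1 then ‖α i‖ ^ 2 else 0 := by
  classical
  have hval (i : ι) : (∑ j, α j • ket (z j)) (z i) = α i := by
    simp [Finset.sum_apply, ket_apply, hz.eq_iff]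
  have hzero (x : Bits m) (hx : x ∉ Finset.univ.image z) : (∑ j, α j • ket (z j)) x = 0 := by
    simp only [Finset.mem_image, Finset.mem_univ, true_and, not_exists] at hx
    simp [Finset.sum_apply, ket_apply, fun j => Ne.symm (hx j)]
  rw [← Finset.sum_subset (Finset.subset_univ (Finset.univ.image z)) fun x _ hx => by
    simp [hzero x hx], Finset.sum_image hz.injOn]
  simp only [hval]

/-! ### Reversible classical circuits -/

/-- The gates that permute the computational basis. -/
inductive ClassicalGate (m : ℕ)
  | not (t : Fin m)
  | cnot (a t : Fin m) (h : a ≠ t)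
  | toffoli (a b t : Fin m) (h : a ≠ b ∧ a ≠ t ∧ b ≠ t)

/-- The wire that a classical gate may flip. -/
def ClassicalGate.target : ClassicalGate m → Fin m
  | .not t => t
  | .cnot _ t _ => t
  | .toffoli _ _ t _ => t

/-- The wires that decide whether a classical gate flips its target. -/
def ClassicalGate.controls : ClassicalGate m → List (Fin m)
  | .not _ => []
  | .cnot a _ _ => [a]
  | .toffoli a b _ _ => [a, b]

/-- The bit that a classical gate adds to its target. -/
def ClassicalGate.value (g : ClassicalGate m) (z : Bits m) : Fin 2 := (g.controls.map z).prod

/-- The permutation of the basis states by a classical gate. -/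
def ClassicalGate.action (z : Bits m) (g : ClassicalGate m) : Bits m :=
  Function.update z g.target (z g.target + g.value z)

/-- A classical gate as an operation of a circuit. -/
def ClassicalGate.toGate (n : ℕ) : ClassicalGate m → Gate n m
  | .not t => ⟨.X, ![t], Function.injective_of_subsingleton _⟩
  | .cnot a t h => ⟨.CNOT, ![a, t], by
      intro i j; fin_cases i <;> fin_cases j <;> simp [h, h.symm]⟩
  | .toffoli a b t h => ⟨.Toffoli, ![a, b, t], by
      intro i j; fin_cases i <;> fin_cases j <;> simp [h, h.1.symm, h.2.1.symm, h.2.2.symm]⟩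

lemma ClassicalGate.target_notMem_controls (g : ClassicalGate m) : g.target ∉ g.controls := by
  cases g <;> simp_all [target, controls, eq_comm]

lemma ClassicalGate.toGate_op_mulVec_ket (U : UGroup n) (g : ClassicalGate m) (z : Bits m) :
    ((g.toGate n).op U).mulVec (ket z) = ket (g.action z) := by
  cases g with
  | not t =>
    refine onWires_mulVec_ket_eq_ket (l := 1) (fun x => ?_) fun j hj =>
      Function.update_of_ne (fun h => hj ⟨(0 : Fin 1), h.symm⟩) _ _
    have hx : x = action z (not t) ∘ ![t] ↔ x 0 = z t + 1 := by
      simp [action, target, value, controls, funext_iff]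
    refine Eq.trans ?_ (if_congr hx rfl rfl).symm
    change (!![0, 1; 1, 0] : Matrix (Fin 2) (Fin 2) ℂ) (x 0) (z t) = _
    generalize x 0 = b, z t = c
    fin_cases b <;> fin_cases c <;> simp
  | cnot a t h =>
    refine onWires_mulVec_ket_eq_ket (l := 2) (fun x => if_congr ?_ rfl rfl) fun j hj =>
      Function.update_of_ne (fun h => hj ⟨(1 : Fin 2), h.symm⟩) _ _
    change x 0 = z a ∧ x 1 = z t + z a ↔
      x = Function.update z t (z t + ([a].map z).prod) ∘ ![a, t]
    simp [funext_iff, Fin.forall_fin_succ, h]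
  | toffoli a b t h =>
    refine onWires_mulVec_ket_eq_ket (l := 3) (fun x => if_congr ?_ rfl rfl) fun j hj =>
      Function.update_of_ne (fun h => hj ⟨(2 : Fin 3), h.symm⟩) _ _
    change x 0 = z a ∧ x 1 = z b ∧ x 2 = z t + z a * z b ↔
      x = Function.update z t (z t + ([a, b].map z).prod) ∘ ![a, b, t]
    simp [funext_iff, Fin.forall_fin_succ, h]

/-- The effect of a list of classical gates on a basis state. -/
def evalGates (gs : List (ClassicalGate m)) (z : Bits m) : Bits m := gs.foldl ClassicalGate.action z

lemma gatesOp_map_toGate_mulVec_ket (U : UGroup n) (gs : List (ClassicalGate m)) (z : Bits m) :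
    (gatesOp U (gs.map (ClassicalGate.toGate n))).mulVec (ket z) = ket (evalGates gs z) := by
  induction gs generalizing z with
  | nil => simp [gatesOp_nil, evalGates]
  | cons g gs ih =>
    rw [List.map_cons, gatesOp_cons, ← Matrix.mulVec_mulVec, g.toGate_op_mulVec_ket, ih]
    rfl

lemma evalGates_append (gs gs' : List (ClassicalGate m)) (z : Bits m) :
    evalGates (gs ++ gs') z = evalGates gs' (evalGates gs z) := List.foldl_append

lemma evalGates_apply_of_forall_ne {gs : List (ClassicalGate m)} {t : Fin m}
    (h : ∀ g ∈ gs, g.target ≠ t) (z : Bits m) : evalGates gs z t = z t := by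
  induction gs generalizing z with
  | nil => rfl
  | cons g gs ih =>
    rw [List.forall_mem_cons] at h
    exact (ih h.2 _).trans (Function.update_of_ne h.1.symm _ _)

lemma evalGates_apply_of_pairwise {gs : List (ClassicalGate m)}
    (h : gs.Pairwise fun g g' => g'.target ∉ g.controls) (z : Bits m) (t : Fin m) :
    evalGates gs z t =
      z t + (gs.map fun g => if g.target = t then g.value (evalGates gs z) else 0).sum := by
  induction gs generalizing z with
  | nil => simp [evalGates]
  | cons g gs ih =>
    rw [List.pairwise_cons] at h
    have hcontrols (a : Fin m) (ha : a ∈ g.controls) : evalGates gs (g.action z) a = z a :=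
      (evalGates_apply_of_forall_ne (fun g' hg' h' => h.1 g' hg' (h' ▸ ha)) _).trans
        (Function.update_of_ne (ne_of_mem_of_not_mem ha g.target_notMem_controls) _ _)
    have hvalue : g.value (evalGates gs (g.action z)) = g.value z :=
      congrArg List.prod (List.map_congr_left hcontrols)
    have haction : g.action z t = z t + if g.target = t then g.value z else 0 := by
      rw [ClassicalGate.action, Function.update_apply]
      split_ifs with h' h'' h''
      · rw [h']
      · exact absurd h'.symm h''
      · exact absurd h''.symm h'
      · rw [add_zero]
    change evalGates gs (g.action z) t = _
    rw [ih h.2, haction, List.map_cons, List.sum_cons, add_assoc]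
    simp only [evalGates, List.foldl_cons] at hvalue ⊢
    rw [hvalue]

/-! ### Hadamard gates -/

/-- The Hadamard gate on a given wire. -/
def gateH (n : ℕ) (t : Fin m) : Gate n m := ⟨.H, ![t], Function.injective_of_subsingleton _⟩

/-- The amplitude `1 / √2`. -/
def invSqrtTwo : ℂ := ((1 / Real.sqrt 2 : ℝ) : ℂ)

lemma norm_invSqrtTwo_sq : ‖invSqrtTwo‖ ^ 2 = 1 / 2 := by
  rw [invSqrtTwo, Complex.norm_real, Real.norm_eq_abs, sq_abs, div_pow, one_pow,
    Real.sq_sqrt (by norm_num)]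

lemma gateH_op_mulVec_ket (U : UGroup n) (t : Fin m) (z : Bits m) :
    ((gateH n t).op U).mulVec (ket z) =
      invSqrtTwo • ∑ b : Fin 2, (-1 : ℂ) ^ (z t * b : ℕ) • ket (Function.update z t b) := by
  have hextend (a : Bits 1) : Function.extend ![t] a z = Function.update z t (a 0) := by
    funext j
    by_cases hj : j = t
    · subst hj
      rw [Function.update_self]
      exact (Function.injective_of_subsingleton ![j]).extend_apply a z 0
    · rw [Function.update_of_ne hj, Function.extend_apply']
      exact fun ⟨_, hi⟩ => hj (by simpa using hi.symm)
  have hentry (a b : Fin 2) : (!![1, 1; 1, -1] : Matrix (Fin 2) (Fin 2) ℂ) b a =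
      (-1) ^ (a * b : ℕ) := by
    fin_cases a <;> fin_cases b <;> simp
  calc ((gateH n t).op U).mulVec (ket z)
      = ∑ a : Bits 1, (invSqrtTwo * (!![1, 1; 1, -1] : Matrix (Fin 2) (Fin 2) ℂ) (a 0) (z t)) •
          ket (Function.extend ![t] a z) := onWires_mulVec_ket _ _ z
    _ = _ := by simp [sum_bits_succ, hextend, hentry, mul_smul]

lemma gatesOp_ofFn_gateH_mulVec_ket (U : UGroup n) {N : ℕ} (e : Fin N ↪ Fin m) {z : Bits m}
    (hz : ∀ i, z (e i) = 0) :
    (gatesOp U (List.ofFn fun i => gateH n (e i))).mulVec (ket z) =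
      invSqrtTwo ^ N • ∑ ρ : Bits N, ket (Function.extend e ρ z) := by
  induction N generalizing z with
  | zero =>
    have hextend (ρ : Bits 0) : Function.extend e ρ z = z :=
      funext fun j => Function.extend_apply' _ _ _ fun ⟨i, _⟩ => i.elim0
    simp [hextend, gatesOp_nil]
  | succ N ih =>
    have hextend (b : Fin 2) (ρ : Bits N) :
        Function.extend e (Fin.cons b ρ) z =
          Function.extend ((Fin.succEmb N).trans e) ρ (Function.update z (e 0) b) := by
      funext j
      by_cases hj : ∃ i, e i = j
      · obtain ⟨i, rfl⟩ := hj
        rw [e.injective.extend_apply]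
        refine Fin.cases ?_ (fun i => ?_) i
        · refine Eq.trans ?_ (Function.extend_apply' _ _ _
            fun ⟨i, hi⟩ => Fin.succ_ne_zero i (e.injective hi)).symm
          rw [Fin.cons_zero, Function.update_self]
        · exact (((Fin.succEmb N).trans e).injective.extend_apply ρ _ i).symm
      · rw [Function.extend_apply' _ _ _ hj, Function.extend_apply' _ _ _
          fun ⟨i, hi⟩ => hj ⟨i.succ, hi⟩, Function.update_of_ne fun h => hj ⟨0, h.symm⟩]
    rw [List.ofFn_succ, gatesOp_cons, ← Matrix.mulVec_mulVec, gateH_op_mulVec_ket, hz 0]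
    simp only [Fin.val_zero, zero_mul, pow_zero, one_smul, Matrix.mulVec_smul, Matrix.mulVec_sum]
    rw [sum_bits_succ, pow_succ', mul_smul, Finset.smul_sum (r := invSqrtTwo ^ N)]
    congr 1
    refine Finset.sum_congr rfl fun b _ => ?_
    simp only [hextend]
    refine ih ((Fin.succEmb N).trans e) fun i => ?_
    exact (Function.update_of_ne (e.injective.ne (Fin.succ_ne_zero i)) _ _).trans (hz _)

/-! ### The register of the swap test -/

/-- The number of wires of the swap test. -/
def regWidth (n k : ℕ) : ℕ := (n + 1) * (k + 3) * 7

/-- The wires of the swap test form a grid with `n + 1` rows and `k + 3` columns, of seven wires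
each: a coin, a conjunction of coins, a qubit of the first and of the second copy, a mark, the
control, and an ancilla. Only the wires with the names below are used. -/
def wire (i : Fin (n + 1)) (j : Fin (k + 3)) (κ : Fin 7) : Fin (regWidth n k) :=
  finProdFinEquiv (finProdFinEquiv (i, j), κ)

lemma val_wire (i : Fin (n + 1)) (j : Fin (k + 3)) (κ : Fin 7) :
    (wire i j κ : ℕ) = κ + 7 * (j + (k + 3) * i) := rfl

@[simp]
lemma wire_inj {i i' : Fin (n + 1)} {j j' : Fin (k + 3)} {κ κ' : Fin 7} :
    wire i j κ = wire i' j' κ' ↔ i = i' ∧ j = j' ∧ κ = κ' := by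
  refine finProdFinEquiv.apply_eq_iff_eq.trans ?_
  simp [and_assoc]

/-- The wires of the coins. -/
abbrev coinWire (i : Fin n) (j : Fin (k + 3)) : Fin (regWidth n k) := wire i.castSucc j 0

/-- The wires of the conjunctions of the first `j` of the coins that may start a run. -/
abbrev conjWire (i : Fin n) (j : Fin (k + 1)) : Fin (regWidth n k) :=
  wire i.castSucc j.castSucc.castSucc 1

/-- The wires of the first copy. -/
abbrev xWire (k : ℕ) (i : Fin n) : Fin (regWidth n k) := wire i.castSucc 0 2

/-- The wires of the second copy. -/
abbrev yWire (k : ℕ) (i : Fin n) : Fin (regWidth n k) := wire i.castSucc 0 3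

/-- The wires of the marks. The mark of site `i` is in row `i + 1`; the wire in row `0` stays in
the state `0`. -/
abbrev markWire (k : ℕ) (i : Fin (n + 1)) : Fin (regWidth n k) := wire i 0 4

/-- The wire of the control qubit. -/
abbrev ctlWire (n k : ℕ) : Fin (regWidth n k) := wire 0 0 5

/-- The wire of the ancilla. -/
abbrev ancWire (n k : ℕ) : Fin (regWidth n k) := wire 0 0 6

/-! ### Tossing the coins and marking the sites -/

/-- The gates that put all coins into uniform superposition. -/
def tossGates (n k : ℕ) : List (Gate n (regWidth n k)) :=
  List.ofFn fun p : Fin (n * (k + 3)) =>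
    gateH n (coinWire (finProdFinEquiv.symm p).1 (finProdFinEquiv.symm p).2)

/-- The basis state in which the coins show `ρ`, and all other wires are `0`. -/
def coinState (ρ : Fin n → Bits (k + 3)) : Bits (regWidth n k) :=
  Function.extend (fun p : Fin n × Fin (k + 3) => coinWire p.1 p.2) (fun p => ρ p.1 p.2) 0

lemma coinWire_injective :
    Function.Injective fun p : Fin n × Fin (k + 3) => coinWire p.1 p.2 := by
  rintro ⟨i, j⟩ ⟨i', j'⟩ h
  simpa using h

lemma coinState_coinWire (ρ : Fin n → Bits (k + 3)) (i : Fin n) (j : Fin (k + 3)) :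
    coinState ρ (coinWire i j) = ρ i j :=
  coinWire_injective.extend_apply _ _ (i, j)

lemma coinState_wire_of_ne (ρ : Fin n → Bits (k + 3)) (i : Fin (n + 1)) (j : Fin (k + 3))
    {κ : Fin 7} (hκ : κ ≠ 0) : coinState ρ (wire i j κ) = 0 :=
  Function.extend_apply' _ _ _ fun ⟨_, h⟩ => hκ (wire_inj.1 h).2.2.symm

lemma gatesOp_tossGates_mulVec_ket (U : UGroup n) :
    (gatesOp U (tossGates n k)).mulVec (ket 0) =
      invSqrtTwo ^ (n * (k + 3)) • ∑ ρ : Fin n → Bits (k + 3), ket (coinState ρ) := by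
  refine (gatesOp_ofFn_gateH_mulVec_ket U
    (finProdFinEquiv.symm.toEmbedding.trans ⟨_, coinWire_injective⟩) fun _ => rfl).trans ?_
  congr 1
  refine Fintype.sum_equiv ((finProdFinEquiv.symm.arrowCongr (Equiv.refl _)).trans
    (Equiv.curry _ _ _)) _ _ fun ρ => congrArg ket ?_
  funext t
  by_cases ht : ∃ p : Fin n × Fin (k + 3), coinWire p.1 p.2 = t
  · obtain ⟨p, rfl⟩ := ht
    have h := (finProdFinEquiv.symm.toEmbedding.trans
      ⟨_, coinWire_injective⟩).injective.extend_apply ρ (0 : Bits (regWidth n k))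
        (finProdFinEquiv p)
    rw [coinState_coinWire]
    simpa using h
  · refine (Function.extend_apply' _ _ _ ?_).trans (Function.extend_apply' _ _ _ ht).symm
    exact fun ⟨q, hq⟩ => ht ⟨_, hq⟩

/-- The gates that copy the two input coins of site `i`, and compute its mark from the mark of the
preceding site. -/
def siteMarkGates (k : ℕ) (i : Fin n) : List (ClassicalGate (regWidth n k)) :=
  [.cnot (coinWire i 1) (xWire k i) (by simp), .cnot (coinWire i 2) (yWire k i) (by simp),
    .not (conjWire i 0)] ++
  ((List.finRange k).map fun j =>
    .toffoli (conjWire i j.castSucc) (coinWire i j.succ.succ.succ) (conjWire i j.succ)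
      (by simp [Fin.castSucc_lt_succ.ne])) ++
  [.cnot (conjWire i (Fin.last k)) (markWire k i.succ) (by simp),
    .toffoli (coinWire i 0) (markWire k i.castSucc) (markWire k i.succ)
      (by simp [Fin.castSucc_lt_succ.ne])]

/-- The gates that compute the marks of all sites. -/
def markGates (n k : ℕ) : List (ClassicalGate (regWidth n k)) :=
  (List.finRange n).flatMap (siteMarkGates k)

lemma pairwise_markGates (n k : ℕ) :
    (markGates n k).Pairwise fun g g' => g'.target ∉ g.controls := by
  rw [markGates, List.pairwise_flatMap]
  constructor
  · intro i _
    have hconj : (List.finRange k).Pairwise fun j j' =>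
        j'.castSucc.castSucc.succ ≠ j.castSucc.castSucc.castSucc :=
      (List.pairwise_lt_finRange k).imp fun h =>
        (Fin.castSucc_lt_succ_iff.2 (Fin.castSucc_le_castSucc_iff.2 h.le)).ne'
    simpa [siteMarkGates, ClassicalGate.target, ClassicalGate.controls, List.pairwise_append,
      List.pairwise_map, or_imp, forall_and] using hconj
  · refine (List.pairwise_lt_finRange n).imp fun {i i'} hi => ?_
    simp [siteMarkGates, ClassicalGate.target, ClassicalGate.controls, or_imp, forall_and, hi.ne',
      (Fin.castSucc_lt_succ_iff.2 hi.le).ne']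

/-- The basis state after the computation of the marks. -/
def markState (ρ : Fin n → Bits (k + 3)) : Bits (regWidth n k) :=
  evalGates (markGates n k) (coinState ρ)

lemma markState_apply (ρ : Fin n → Bits (k + 3)) (t : Fin (regWidth n k)) :
    markState ρ t = coinState ρ t + ∑ i, ((siteMarkGates k i).map fun g =>
      if g.target = t then g.value (markState ρ) else 0).sum := by
  rw [markState, evalGates_apply_of_pairwise (pairwise_markGates n k), markGates,
    List.map_flatMap, List.flatMap_def, List.sum_flatten, List.map_map, Fin.sum_univ_def]
  rfl

lemma markState_coinWire (ρ : Fin n → Bits (k + 3)) (i : Fin n) (j : Fin (k + 3)) :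
    markState ρ (coinWire i j) = ρ i j := by
  simp [markState_apply, siteMarkGates, ClassicalGate.target, Function.comp_def, coinState_coinWire]

lemma markState_xWire (ρ : Fin n → Bits (k + 3)) (i : Fin n) :
    markState ρ (xWire k i) = ρ i 1 := by
  rw [markState_apply]
  simp [siteMarkGates, ClassicalGate.target, ClassicalGate.value, ClassicalGate.controls,
    coinState_wire_of_ne, markState_coinWire, Function.comp_def]

lemma markState_yWire (ρ : Fin n → Bits (k + 3)) (i : Fin n) :
    markState ρ (yWire k i) = ρ i 2 := by
  rw [markState_apply]
  simp [siteMarkGates, ClassicalGate.target, ClassicalGate.value, ClassicalGate.controls,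
    coinState_wire_of_ne, markState_coinWire, Function.comp_def]

lemma markState_conjWire_zero (ρ : Fin n → Bits (k + 3)) (i : Fin n) :
    markState ρ (conjWire i 0) = 1 := by
  rw [markState_apply]
  simp [siteMarkGates, ClassicalGate.target, ClassicalGate.value, ClassicalGate.controls,
    coinState_wire_of_ne, Function.comp_def]

lemma markState_conjWire_succ (ρ : Fin n → Bits (k + 3)) (i : Fin n) (j : Fin k) :
    markState ρ (conjWire i j.succ) =
      markState ρ (conjWire i j.castSucc) * ρ i j.succ.succ.succ := by
  rw [markState_apply]
  simp [siteMarkGates, ClassicalGate.target, ClassicalGate.value, ClassicalGate.controls,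
    coinState_wire_of_ne, markState_coinWire, Function.comp_def, ite_and,
    (Fin.succ_ne_zero _).symm, ← Fin.sum_univ_def]

lemma markState_conjWire (ρ : Fin n → Bits (k + 3)) (i : Fin n) :
    markState ρ (conjWire i (Fin.last k)) = ∏ j : Fin k, ρ i j.succ.succ.succ := by
  have hpartial (j : Fin (k + 1)) :
      markState ρ (conjWire i j) = Fin.partialProd (fun j => ρ i j.succ.succ.succ) j := by
    induction j using Fin.induction with
    | zero => rw [markState_conjWire_zero, Fin.partialProd_zero]
    | succ j ih => rw [markState_conjWire_succ, ih, Fin.partialProd_succ]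
  rw [hpartial, Fin.partialProd, List.take_of_length_le (by simp), List.prod_ofFn]

lemma markState_markWire_zero (ρ : Fin n → Bits (k + 3)) : markState ρ (markWire k 0) = 0 := by
  rw [markState_apply]
  simp [siteMarkGates, ClassicalGate.target, coinState_wire_of_ne, Function.comp_def]

lemma markState_markWire_succ (ρ : Fin n → Bits (k + 3)) (i : Fin n) :
    markState ρ (markWire k i.succ) = markStep (ρ i) (markState ρ (markWire k i.castSucc)) := by
  rw [markState_apply, markStep, ← markState_conjWire]
  simp [siteMarkGates, ClassicalGate.target, ClassicalGate.value, ClassicalGate.controls,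
    coinState_wire_of_ne, markState_coinWire, Function.comp_def, Finset.sum_add_distrib]

lemma markState_ctlWire (ρ : Fin n → Bits (k + 3)) : markState ρ (ctlWire n k) = 0 := by
  rw [markState_apply]
  simp [siteMarkGates, ClassicalGate.target, coinState_wire_of_ne, Function.comp_def]

lemma markState_ancWire (ρ : Fin n → Bits (k + 3)) : markState ρ (ancWire n k) = 0 := by
  rw [markState_apply]
  simp [siteMarkGates, ClassicalGate.target, coinState_wire_of_ne, Function.comp_def]

/-- The marks computed from the coins `ρ`. -/
def marks (ρ : Fin n → Bits (k + 3)) : Bits n := fun i => markState ρ (markWire k i.succ)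

lemma markStep_marks (ρ : Fin n → Bits (k + 3)) (i : Fin n) :
    markStep (ρ i) (prevMark (marks ρ) i) = marks ρ i := by
  have hprev : prevMark (marks ρ) i = markState ρ (markWire k i.castSucc) := by
    rw [prevMark]
    cases i.castSucc using Fin.cases with
    | zero => exact (markState_markWire_zero ρ).symm
    | succ j => rfl
  rw [hprev, marks, markState_markWire_succ]

/-! ### The controlled swap and the queries -/

lemma xWire_injective (n k : ℕ) : Function.Injective (xWire (n := n) k) := fun i i' h => by
  simpa using h

lemma yWire_injective (n k : ℕ) : Function.Injective (yWire (n := n) k) := fun i i' h => by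
  simpa using h

/-- The basis state `z` with the qubits of the two copies replaced by `a.1` and `a.2`. -/
def setData (z : Bits (regWidth n k)) (a : Bits n × Bits n) : Bits (regWidth n k) :=
  Function.extend (yWire k) a.2 (Function.extend (xWire k) a.1 z)

lemma setData_yWire (z : Bits (regWidth n k)) (a : Bits n × Bits n) (i : Fin n) :
    setData z a (yWire k i) = a.2 i :=
  (yWire_injective n k).extend_apply _ _ i

lemma setData_of_ne_yWire (z : Bits (regWidth n k)) (a : Bits n × Bits n)
    {t : Fin (regWidth n k)} (ht : ∀ i, t ≠ yWire k i) :
    setData z a t = Function.extend (xWire k) a.1 z t :=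
  Function.extend_apply' _ _ _ fun ⟨i, hi⟩ => ht i hi.symm

lemma setData_xWire (z : Bits (regWidth n k)) (a : Bits n × Bits n) (i : Fin n) :
    setData z a (xWire k i) = a.1 i := by
  rw [setData_of_ne_yWire z a (by simp), (xWire_injective n k).extend_apply]

lemma setData_of_ne (z : Bits (regWidth n k)) (a : Bits n × Bits n) {t : Fin (regWidth n k)}
    (hx : ∀ i, t ≠ xWire k i) (hy : ∀ i, t ≠ yWire k i) : setData z a t = z t := by
  rw [setData_of_ne_yWire z a hy, Function.extend_apply' _ _ _ fun ⟨i, hi⟩ => hx i hi.symm]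

lemma eq_setData {z z' : Bits (regWidth n k)} {a : Bits n × Bits n}
    (hx : ∀ i, z' (xWire k i) = a.1 i) (hy : ∀ i, z' (yWire k i) = a.2 i)
    (hz : ∀ t, (∀ i, t ≠ xWire k i) → (∀ i, t ≠ yWire k i) → z' t = z t) :
    z' = setData z a := by
  funext t
  by_cases htx : ∃ i, t = xWire k i
  · obtain ⟨i, rfl⟩ := htx
    rw [hx, setData_xWire]
  by_cases hty : ∃ i, t = yWire k i
  · obtain ⟨i, rfl⟩ := hty
    rw [hy, setData_yWire]
  push Not at htx hty
  rw [hz t htx hty, setData_of_ne z a htx hty]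

/-- The gates that swap the two copies of the qubit of site `i` if the control and the mark of
site `i` are both `1`. The ancilla stores the product of the two while it is needed. -/
def siteSwapGates (k : ℕ) (i : Fin n) : List (ClassicalGate (regWidth n k)) :=
  [.toffoli (ctlWire n k) (markWire k i.succ) (ancWire n k) (by simp),
    .cnot (yWire k i) (xWire k i) (by simp),
    .toffoli (ancWire n k) (xWire k i) (yWire k i) (by simp),
    .cnot (yWire k i) (xWire k i) (by simp),
    .toffoli (ctlWire n k) (markWire k i.succ) (ancWire n k) (by simp)]

lemma evalGates_siteSwapGates {z : Bits (regWidth n k)} (hz : z (ancWire n k) = 0) (i : Fin n)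
    (a : Bits n × Bits n) :
    evalGates (siteSwapGates k i) (setData z a) =
      setData z (partialSwap (Pi.single i (z (ctlWire n k) * z (markWire k i.succ))) a) := by
  have hctl : setData z a (ctlWire n k) = z (ctlWire n k) := setData_of_ne _ _ (by simp) (by simp)
  have hmark : setData z a (markWire k i.succ) = z (markWire k i.succ) :=
    setData_of_ne _ _ (by simp) (by simp)
  have hanc : setData z a (ancWire n k) = 0 := (setData_of_ne _ _ (by simp) (by simp)).trans hz
  have hx (b x y : Fin 2) : x + y + (y + b * (x + y)) = if b = 1 then y else x := by
    revert b x y; decide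
  have hy (b x y : Fin 2) : y + b * (x + y) = if b = 1 then x else y := by revert b x y; decide
  have hadd (b : Fin 2) : b + b = 0 := by revert b; decide
  refine eq_setData (fun i' => ?_) (fun i' => ?_) fun t htx hty => ?_
  · by_cases hi : i' = i
    · subst hi
      simp [siteSwapGates, evalGates, ClassicalGate.action, ClassicalGate.target,
        ClassicalGate.value, ClassicalGate.controls, partialSwap_apply, setData_xWire,
        setData_yWire, hctl, hmark, hanc, hx]
    · simp [siteSwapGates, evalGates, ClassicalGate.action, ClassicalGate.target,
        partialSwap_apply, setData_xWire, hi]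
  · by_cases hi : i' = i
    · subst hi
      simp [siteSwapGates, evalGates, ClassicalGate.action, ClassicalGate.target,
        ClassicalGate.value, ClassicalGate.controls, partialSwap_apply, setData_xWire,
        setData_yWire, hctl, hmark, hanc, hy]
    · simp [siteSwapGates, evalGates, ClassicalGate.action, ClassicalGate.target,
        partialSwap_apply, setData_yWire, hi]
  · by_cases hanct : t = ancWire n k
    · subst hanct
      simp [siteSwapGates, evalGates, ClassicalGate.action, ClassicalGate.target,
        ClassicalGate.value, ClassicalGate.controls, hctl, hmark, hanc, hz, hadd]
    · simp [siteSwapGates, evalGates, ClassicalGate.action, ClassicalGate.target,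
        htx, hty, hanct, setData_of_ne z a htx hty]

/-- The controlled swap of the marked sites of the two copies. -/
def swapGates (n k : ℕ) : List (ClassicalGate (regWidth n k)) :=
  (List.finRange n).flatMap (siteSwapGates k)

lemma partialSwap_add (w w' : Bits n) :
    partialSwap (w + w') = partialSwap w' * partialSwap w := by
  have hbit (b b' : Fin 2) (x y : Fin 2) : (if b + b' = 1 then x else y) =
      if b' = 1 then (if b = 1 then y else x) else if b = 1 then x else y := by
    revert b b' x y
    decide
  ext q i <;> simp only [partialSwap_apply, Equiv.Perm.mul_apply, Pi.add_apply, hbit]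

lemma evalGates_swapGates {z : Bits (regWidth n k)} (hz : z (ancWire n k) = 0)
    (a : Bits n × Bits n) :
    evalGates (swapGates n k) (setData z a) =
      setData z (partialSwap (fun i => z (ctlWire n k) * z (markWire k i.succ)) a) := by
  have hlist (is : List (Fin n)) (a : Bits n × Bits n) :
      evalGates (is.flatMap (siteSwapGates k)) (setData z a) = setData z (partialSwap
        (is.map fun i => Pi.single i (z (ctlWire n k) * z (markWire k i.succ))).sum a) := by
    induction is generalizing a with
    | nil => simp [evalGates, partialSwap_zero]
    | cons i is ih =>
      rw [List.flatMap_cons, evalGates_append, evalGates_siteSwapGates hz, ih, List.map_cons,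
        List.sum_cons, partialSwap_add, Equiv.Perm.mul_apply]
  rw [swapGates, hlist, ← Fin.sum_univ_def, Finset.univ_sum_single]

/-- The two parallel queries. -/
def queryGates (n k : ℕ) : List (Gate n (regWidth n k)) :=
  [⟨.query, xWire k, xWire_injective n k⟩, ⟨.query, yWire k, yWire_injective n k⟩]

lemma gatesOp_queryGates_mulVec_ket (U : UGroup n) (z : Bits (regWidth n k))
    (a : Bits n × Bits n) :
    (gatesOp U (queryGates n k)).mulVec (ket (setData z a)) =
      ∑ a', ((U : Op n) ⊗ₖ (U : Op n)) a' a • ket (setData z a') := by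
  have hquery (e : Fin n ↪ Fin (regWidth n k)) (z : Bits (regWidth n k)) :
      (Gate.op U ⟨.query, e⟩).mulVec (ket z) = ∑ b, U b (z ∘ e) • ket (Function.extend e b z) :=
    onWires_mulVec_ket e (U : Op n) z
  have hx : setData z a ∘ xWire k = a.1 := funext (setData_xWire z a)
  have hy (b : Bits n) : Function.extend (xWire k) b (setData z a) ∘ yWire k = a.2 := by
    funext i
    exact (Function.extend_apply' _ _ _ (by simp)).trans (setData_yWire z a i)
  have hextend (b b' : Bits n) : Function.extend (yWire k) b'
      (Function.extend (xWire k) b (setData z a)) = setData z (b, b') :=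
    eq_setData (setData_xWire (setData z a) (b, b')) (setData_yWire (setData z a) (b, b'))
      fun t htx hty => (setData_of_ne _ (b, b') htx hty).trans (setData_of_ne z a htx hty)
  simp only [queryGates, gatesOp_cons, gatesOp_nil, one_mul, ← Matrix.mulVec_mulVec, hquery,
    Function.Embedding.coeFn_mk, hx, Matrix.mulVec_sum, Matrix.mulVec_smul, hy, hextend,
    Finset.smul_sum, smul_smul, Fintype.sum_prod_type, Matrix.kroneckerMap_apply]

/-! ### The swap test -/

/-- The basis state `z` with the control set to `b`, and the two copies set to `a.1` and `a.2`. -/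
def branch (z : Bits (regWidth n k)) (b : Fin 2) (a : Bits n × Bits n) : Bits (regWidth n k) :=
  setData (Function.update z (ctlWire n k) b) a

lemma branch_ctlWire (z : Bits (regWidth n k)) (b : Fin 2) (a : Bits n × Bits n) :
    branch z b a (ctlWire n k) = b :=
  (setData_of_ne _ _ (by simp) (by simp)).trans (Function.update_self _ _ _)

lemma update_branch (z : Bits (regWidth n k)) (b b' : Fin 2) (a : Bits n × Bits n) :
    Function.update (branch z b a) (ctlWire n k) b' = branch z b' a := by
  refine eq_setData (fun i => ?_) (fun i => ?_) fun t htx hty => ?_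
  · rw [Function.update_of_ne (by simp)]
    exact setData_xWire _ a i
  · rw [Function.update_of_ne (by simp)]
    exact setData_yWire _ a i
  · by_cases ht : t = ctlWire n k
    · subst ht
      rw [Function.update_self, Function.update_self]
    · rw [Function.update_of_ne ht, Function.update_of_ne ht, branch, setData_of_ne _ a htx hty,
        Function.update_of_ne ht]

lemma gateH_ctlWire_mulVec_ket_branch (U : UGroup n) (z : Bits (regWidth n k)) (b : Fin 2)
    (a : Bits n × Bits n) :
    ((gateH n (ctlWire n k)).op U).mulVec (ket (branch z b a)) =
      invSqrtTwo • ∑ b' : Fin 2, (-1 : ℂ) ^ (b * b' : ℕ) • ket (branch z b' a) := by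
  simp only [gateH_op_mulVec_ket, branch_ctlWire, update_branch]

lemma not_ctlWire_mulVec_ket_branch (U : UGroup n) (z : Bits (regWidth n k)) (b : Fin 2)
    (a : Bits n × Bits n) :
    (((ClassicalGate.not (ctlWire n k)).toGate n).op U).mulVec (ket (branch z b a)) =
      ket (branch z (b + 1) a) := by
  rw [ClassicalGate.toGate_op_mulVec_ket, ClassicalGate.action]
  simp only [ClassicalGate.target, ClassicalGate.value, ClassicalGate.controls, List.map_nil,
    List.prod_nil, branch_ctlWire, update_branch]

lemma gatesOp_swapGates_mulVec_ket_branch (U : UGroup n) {z : Bits (regWidth n k)}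
    (hz : z (ancWire n k) = 0) (b : Fin 2) (a : Bits n × Bits n) :
    (gatesOp U ((swapGates n k).map (ClassicalGate.toGate n))).mulVec (ket (branch z b a)) =
      ket (branch z b (partialSwap (fun i => b * z (markWire k i.succ)) a)) := by
  have hanc : Function.update z (ctlWire n k) b (ancWire n k) = 0 := by simpa using hz
  rw [gatesOp_map_toGate_mulVec_ket, branch, evalGates_swapGates hanc]
  simp [branch]

/-- The gates of the swap test after the marks have been computed: the control decides whether the
marked sites of the two copies are swapped before or after the queries. -/
def testGates (n k : ℕ) : List (Gate n (regWidth n k)) :=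
  gateH n (ctlWire n k) :: (swapGates n k).map (ClassicalGate.toGate n) ++ queryGates n k ++
    ((ClassicalGate.not (ctlWire n k)).toGate n ::
      (swapGates n k).map (ClassicalGate.toGate n) ++ [gateH n (ctlWire n k)])

lemma sum_smul_partialSwap {E : Type*} [AddCommGroup E] [Module ℂ E] (w : Bits n)
    (M : Matrix (Bits n × Bits n) (Bits n × Bits n) ℂ) (a : Bits n × Bits n)
    (ψ : Bits n × Bits n → E) :
    ∑ a', M a' a • ψ (partialSwap w a') = ∑ a', (swapMatrix w * M) a' a • ψ a' := by
  refine Fintype.sum_equiv (partialSwap w) _ _ fun a' => ?_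
  have hinvol : partialSwap w (partialSwap w a') = a' := by
    conv_lhs => rw [← partialSwap_symm w]
    exact (partialSwap w).symm_apply_apply a'
  rw [swapMatrix_mul_apply, hinvol]

lemma gatesOp_testGates_mulVec_ket (U : UGroup n) {z : Bits (regWidth n k)}
    (hz : z (ancWire n k) = 0) (a : Bits n × Bits n) :
    let w : Bits n := fun i => z (markWire k i.succ)
    let V := (U : Op n) ⊗ₖ (U : Op n)
    (gatesOp U (testGates n k)).mulVec (ket (branch z 0 a)) =
      invSqrtTwo ^ 2 • ∑ p : Fin 2 × (Bits n × Bits n),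
        ((V * swapMatrix w) p.2 a + (-1) ^ (p.1 : ℕ) * (swapMatrix w * V) p.2 a) •
          ket (branch z p.1 p.2) := by
  intro w V
  have hswap₀ (a : Bits n × Bits n) :
      (gatesOp U ((swapGates n k).map (ClassicalGate.toGate n))).mulVec (ket (branch z 0 a)) =
        ket (branch z 0 a) := by
    rw [gatesOp_swapGates_mulVec_ket_branch U hz]
    simp only [zero_mul]
    exact congrArg (fun σ : Equiv.Perm _ => ket (branch z 0 (σ a))) partialSwap_zero
  have hswap₁ (a : Bits n × Bits n) :
      (gatesOp U ((swapGates n k).map (ClassicalGate.toGate n))).mulVec (ket (branch z 1 a)) =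
        ket (branch z 1 (partialSwap w a)) := by
    rw [gatesOp_swapGates_mulVec_ket_branch U hz]
    simp only [one_mul, w]
  have hquery (b : Fin 2) (a : Bits n × Bits n) :
      (gatesOp U (queryGates n k)).mulVec (ket (branch z b a)) =
        ∑ a', V a' a • ket (branch z b a') := gatesOp_queryGates_mulVec_ket U _ a
  have hcomp (b : Fin 2) := sum_smul_partialSwap w V a fun a' => ket (branch z b a')
  have hsmul (f : Bits n × Bits n → ℂ) (ψ : Bits n × Bits n → Bits (regWidth n k) → ℂ) :
      ∑ a, f a • invSqrtTwo • ψ a = invSqrtTwo • ∑ a, f a • ψ a := by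
    simp only [Finset.smul_sum, smul_comm invSqrtTwo]
  have htwo : (1 + 1 : Fin 2) = 0 := rfl
  rw [Fintype.sum_prod_type]
  simp only [testGates, gatesOp_append, gatesOp_cons, gatesOp_nil, one_mul, List.cons_append,
    ← Matrix.mulVec_mulVec, gateH_ctlWire_mulVec_ket_branch, not_ctlWire_mulVec_ket_branch,
    Matrix.mulVec_smul, Matrix.mulVec_add, Matrix.mulVec_sum, zero_add, htwo, hswap₀, hswap₁,
    hquery, Fin.sum_univ_two, mul_swapMatrix_apply, add_smul, Finset.sum_add_distrib, mul_smul,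
    ← Finset.smul_sum, smul_add, hsmul]
  simp only [Fin.val_zero, Fin.val_one, mul_zero, mul_one, pow_zero, pow_one,
    one_smul, neg_smul, smul_neg, Finset.sum_neg_distrib, hcomp]
  module

lemma markState_eq_branch (ρ : Fin n → Bits (k + 3)) :
    markState ρ = branch (markState ρ) 0 (fun i => ρ i 1, fun i => ρ i 2) := by
  refine eq_setData (markState_xWire ρ) (markState_yWire ρ) fun t _ _ => ?_
  rw [← markState_ctlWire ρ, Function.update_eq_self]

lemma branch_markState_injective :
    Function.Injective fun p : (Fin n → Bits (k + 3)) × Fin 2 × (Bits n × Bits n) =>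
      branch (markState p.1) p.2.1 p.2.2 := by
  have hcoin (ρ : Fin n → Bits (k + 3)) (b : Fin 2) (a : Bits n × Bits n) (i : Fin n)
      (j : Fin (k + 3)) : branch (markState ρ) b a (coinWire i j) = ρ i j := by
    rw [branch, setData_of_ne _ _ (by simp) (by simp), Function.update_of_ne (by simp),
      markState_coinWire]
  rintro ⟨ρ, b, x, y⟩ ⟨ρ', b', x', y'⟩ h
  have hwire (t : Fin (regWidth n k)) := congrFun h t
  refine Prod.ext (funext fun i => funext fun j => ?_) (Prod.ext ?_
    (Prod.ext (funext fun i => ?_) (funext fun i => ?_)))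
  · simpa only [hcoin] using hwire (coinWire i j)
  · simpa only [branch_ctlWire] using hwire (ctlWire n k)
  · simpa only [branch, setData_xWire] using hwire (xWire k i)
  · simpa only [branch, setData_yWire] using hwire (yWire k i)

/-- All gates of the swap test with random marks. -/
def swapCircuitGates (n k : ℕ) : List (Gate n (regWidth n k)) :=
  tossGates n k ++ (markGates n k).map (ClassicalGate.toGate n) ++ testGates n k

/-- The final amplitude of the basis state `branch (markState ρ) b a`. -/
def amplitude (U : UGroup n) (ρ : Fin n → Bits (k + 3)) (b : Fin 2) (a : Bits n × Bits n) : ℂ :=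
  let V := (U : Op n) ⊗ₖ (U : Op n)
  invSqrtTwo ^ (n * (k + 3) + 2) *
    ((V * swapMatrix (marks ρ)) a (fun i => ρ i 1, fun i => ρ i 2) +
      (-1) ^ (b : ℕ) * (swapMatrix (marks ρ) * V) a (fun i => ρ i 1, fun i => ρ i 2))

lemma gatesOp_swapCircuitGates_mulVec_ket (U : UGroup n) :
    (gatesOp U (swapCircuitGates n k)).mulVec (ket 0) =
      ∑ p : (Fin n → Bits (k + 3)) × Fin 2 × (Bits n × Bits n),
        amplitude U p.1 p.2.1 p.2.2 • ket (branch (markState p.1) p.2.1 p.2.2) := by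
  have htest (ρ : Fin n → Bits (k + 3)) := gatesOp_testGates_mulVec_ket U (markState_ancWire ρ)
    (fun i => ρ i 1, fun i => ρ i 2)
  simp only [swapCircuitGates, gatesOp_append, ← Matrix.mulVec_mulVec,
    gatesOp_tossGates_mulVec_ket, Matrix.mulVec_smul, Matrix.mulVec_sum,
    gatesOp_map_toGate_mulVec_ket]
  rw [Fintype.sum_prod_type, Finset.smul_sum]
  refine Finset.sum_congr rfl fun ρ _ => ?_
  rw [← markState, markState_eq_branch, htest, smul_smul, ← pow_add, Finset.smul_sum]
  simp only [smul_smul]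
  rfl

/-- The circuit of the swap test with random marks. -/
def swapCircuit (n k : ℕ) : Circuit n where
  width := regWidth n k
  gates := swapCircuitGates n k
  out := ctlWire n k

lemma acceptProb_swapCircuit_eq_sum_commutator (n k : ℕ) (U : UGroup n) :
    (swapCircuit n k).acceptProb U = (1 / 2) ^ (n * (k + 3) + 2) *
      ∑ ρ : Fin n → Bits (k + 3), ∑ s, ‖(swapMatrix (marks ρ) * ((U : Op n) ⊗ₖ (U : Op n)) -
        ((U : Op n) ⊗ₖ (U : Op n)) * swapMatrix (marks ρ)) s
          (fun i => ρ i 1, fun i => ρ i 2)‖ ^ 2 := by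
  have hamplitude (ρ : Fin n → Bits (k + 3)) (s : Bits n × Bits n) :
      ‖amplitude U ρ 1 s‖ ^ 2 = (1 / 2) ^ (n * (k + 3) + 2) *
        ‖(swapMatrix (marks ρ) * ((U : Op n) ⊗ₖ (U : Op n)) -
          ((U : Op n) ⊗ₖ (U : Op n)) * swapMatrix (marks ρ)) s
            (fun i => ρ i 1, fun i => ρ i 2)‖ ^ 2 := by
    rw [amplitude, norm_mul, mul_pow, norm_pow, ← pow_mul, mul_comm _ 2, pow_mul,
      norm_invSqrtTwo_sq, Matrix.sub_apply, ← norm_sub_rev, Fin.val_one, pow_one, neg_one_mul,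
      sub_eq_add_neg]
  calc (swapCircuit n k).acceptProb U
      = ∑ x : Bits (regWidth n k), if x (ctlWire n k) = 1 then
          ‖(gatesOp U (swapCircuitGates n k)).mulVec (ket 0) x‖ ^ 2 else 0 := by
        rw [← foldl_mulVec_eq_gatesOp_mulVec]
        rfl
    _ = ∑ p : (Fin n → Bits (k + 3)) × Fin 2 × (Bits n × Bits n),
          if p.2.1 = 1 then ‖amplitude U p.1 p.2.1 p.2.2‖ ^ 2 else 0 := by
        rw [gatesOp_swapCircuitGates_mulVec_ket, sum_accept branch_markState_injective]
        simp only [branch_ctlWire]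
    _ = ∑ ρ : Fin n → Bits (k + 3), ∑ s, ‖amplitude U ρ 1 s‖ ^ 2 := by
        simp [Fintype.sum_prod_type (α₁ := Fin n → Bits (k + 3)),
          Fintype.sum_prod_type (α₁ := Fin 2)]
    _ = _ := by simp only [hamplitude, Finset.mul_sum]

theorem acceptProb_swapCircuit (n k : ℕ) (U : UGroup n) :
    (swapCircuit n k).acceptProb U =
      1 / 2 * ∑ w : Bits n, markProb k w * (1 - (1 / 4) ^ weight w * transferSum w U) := by
  have hcoins := sum_coins_eq_sum_marks (markStep_marks (n := n) (k := k)) fun w a =>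
    ∑ s, ‖(swapMatrix w * ((U : Op n) ⊗ₖ (U : Op n)) -
      ((U : Op n) ⊗ₖ (U : Op n)) * swapMatrix w) s a‖ ^ 2
  have hcomm (w : Bits n) :
      ∑ a, ∑ s, ‖(swapMatrix w * ((U : Op n) ⊗ₖ (U : Op n)) -
        ((U : Op n) ⊗ₖ (U : Op n)) * swapMatrix w) s a‖ ^ 2 =
        2 * 4 ^ n * (1 - (1 / 4) ^ weight w * transferSum w U) :=
    Finset.sum_comm.trans (sum_norm_sq_commutator_swapMatrix w U)
  have hconst : (1 / 2 : ℝ) ^ (n * (k + 3) + 2) * ((2 ^ (k + 1)) ^ n * (2 * 4 ^ n)) = 1 / 2 := by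
    rw [← pow_mul, show (4 : ℝ) = 2 ^ 2 by norm_num, ← pow_mul, one_div, inv_pow]
    field_simp
    ring
  have hsum : ∑ w, markProb k w * (2 * 4 ^ n * (1 - (1 / 4) ^ weight w * transferSum w U)) =
      2 * 4 ^ n * ∑ w, markProb k w * (1 - (1 / 4) ^ weight w * transferSum w U) := by
    rw [Finset.mul_sum]
    exact Finset.sum_congr rfl fun w _ => mul_left_comm _ _ _
  rw [acceptProb_swapCircuit_eq_sum_commutator, hcoins]
  simp only [hcomm]
  rw [hsum, ← mul_assoc _ (2 * 4 ^ n), ← mul_assoc, hconst]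

lemma ClassicalGate.kind_toGate_ne_query {m : ℕ} (g : ClassicalGate m) :
    (g.toGate n).kind ≠ .query := by
  cases g <;> exact nofun

lemma parallelQueries_swapCircuit (n k : ℕ) : (swapCircuit n k).ParallelQueries 2 := by
  let H : Gate n (regWidth n k) := gateH n (ctlWire n k)
  let X : Gate n (regWidth n k) := (ClassicalGate.not (ctlWire n k)).toGate n
  let marks := (markGates n k).map (ClassicalGate.toGate n)
  let swaps := (swapGates n k).map (ClassicalGate.toGate n)
  have hclassical (gs : List (ClassicalGate (regWidth n k))) :
      ∀ g ∈ gs.map (ClassicalGate.toGate n), g.kind ≠ .query := by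
    simp [ClassicalGate.kind_toGate_ne_query]
  have hgates : swapCircuitGates n k =
      tossGates n k ++ marks ++ H :: swaps ++ queryGates n k ++ (X :: swaps ++ [H]) := by
    simp [swapCircuitGates, testGates, H, X, marks, swaps]
  have htoss : ∀ g ∈ tossGates n k, g.kind ≠ .query := by
    simp [tossGates, gateH]
  refine ⟨tossGates n k ++ marks ++ H :: swaps, queryGates n k, X :: swaps ++ [H], hgates,
    List.forall_mem_append.2 ⟨List.forall_mem_append.2 ⟨htoss, hclassical _⟩,
      List.forall_mem_cons.2 ⟨nofun, hclassical _⟩⟩,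
    List.forall_mem_append.2 ⟨List.forall_mem_cons.2 ⟨nofun, hclassical _⟩,
      List.forall_mem_singleton.2 nofun⟩,
    List.forall_mem_cons.2 ⟨rfl, List.forall_mem_singleton.2 rfl⟩, rfl,
    List.pairwise_pair.2 fun i j h => ?_⟩
  simpa using (wire_inj.1 h).2.2

/-! ### Running programs -/

/-- The program leads from the first to the second state within `T` steps. -/
def RunsTo (p : Prog) (s s' : MState) (T : ℕ) : Prop := ∃ t ≤ T, Exec p s s' t

lemma RunsTo.seq {p p' : Prog} {s s' s'' : MState} {T T' : ℕ} (h : RunsTo p s s' T)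
    (h' : RunsTo p' s' s'' T') : RunsTo (.seq p p') s s'' (T + T') := by
  obtain ⟨t, ht, he⟩ := h
  obtain ⟨t', ht', he'⟩ := h'
  exact ⟨t + t', by lia, he.seq he'⟩

lemma RunsTo.mono {p : Prog} {s s' : MState} {T T' : ℕ} (h : RunsTo p s s' T) (hT : T ≤ T') :
    RunsTo p s s' T' := by
  obtain ⟨t, ht, he⟩ := h
  exact ⟨t, ht.trans hT, he⟩

lemma RunsTo.loop {r : ℕ} {p : Prog} {N T : ℕ} {S : ℕ → MState}
    (hbody : ∀ j < N, (S j).mem r ≠ 0 ∧ RunsTo p (S j) (S (j + 1)) T) (hend : (S N).mem r = 0) :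
    RunsTo (.loop r p) (S 0) (S N) (N * (T + 1) + 1) := by
  induction N generalizing S with
  | zero => exact ⟨1, by lia, .loopStop hend⟩
  | succ N ih =>
    obtain ⟨t', ht', he'⟩ := ih (S := fun j => S (j + 1)) (fun j hj => hbody _ (by lia)) hend
    obtain ⟨hr, t, ht, he⟩ := hbody 0 (by lia)
    exact ⟨t + t' + 1, by rw [Nat.succ_mul]; lia, .loopStep hr he he'⟩

/-- The state of the machine in which the first cells have the given contents, and all others are
blank. -/
def machine (cells out : List ℕ) : MState := ⟨fun r => cells.getD r 0, out⟩

lemma machine_write {cells : List ℕ} (out : List ℕ) {r : ℕ} (hr : r < cells.length) (v : ℕ) :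
    (machine cells out).write r v = machine (cells.set r v) out := by
  refine congrArg (MState.mk · out) (funext fun r' => ?_)
  rcases eq_or_ne r' r with rfl | h
  · simp [machine, hr]
  · simp [machine, h, List.getElem?_set_ne h.symm]

section RunsTo

variable {cells : List ℕ} (out : List ℕ) {r : ℕ}

lemma runsTo_const (hr : r < cells.length) (c : ℕ) :
    RunsTo (.const r c) (machine cells out) (machine (cells.set r c) out) 1 :=
  ⟨1, le_rfl, machine_write out hr c ▸ .const r c _⟩

lemma runsTo_copy (hr : r < cells.length) (r' : ℕ) :
    RunsTo (.copy r r') (machine cells out) (machine (cells.set r (cells.getD r' 0)) out) 1 :=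
  ⟨1, le_rfl, machine_write out hr (cells.getD r' 0) ▸ .copy r r' _⟩

lemma runsTo_plus (hr : r < cells.length) (r' : ℕ) :
    RunsTo (.plus r r') (machine cells out)
      (machine (cells.set r (cells.getD r 0 + cells.getD r' 0)) out) 1 :=
  ⟨1, le_rfl, machine_write out hr (cells.getD r 0 + cells.getD r' 0) ▸ .plus r r' _⟩

lemma runsTo_minus (hr : r < cells.length) (r' : ℕ) :
    RunsTo (.minus r r') (machine cells out)
      (machine (cells.set r (cells.getD r 0 - cells.getD r' 0)) out) 1 :=
  ⟨1, le_rfl, machine_write out hr (cells.getD r 0 - cells.getD r' 0) ▸ .minus r r' _⟩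

lemma runsTo_emit (cells : List ℕ) (r : ℕ) :
    RunsTo (.emit r) (machine cells out) (machine cells (out ++ [cells.getD r 0])) 1 :=
  ⟨1, le_rfl, .emit r _⟩

end RunsTo

/-! ### Writing down descriptions site by site -/

/-- The numbers that the program writes: constants, the width of the circuit, and the wires at a
given distance from the first wire of the current site or of the current coin. -/
inductive Entry
  | lit (c : ℕ)
  | width
  | atSite (c : ℕ)
  | atCoin (c : ℕ)

/-- The value of an entry, for a circuit of width `w` and a site and a coin whose first wires are
`a` and `b`. -/
def Entry.value (w a b : ℕ) : Entry → ℕ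
  | .lit c => c
  | .width => w
  | .atSite c => c + a
  | .atCoin c => c + b

/-- The constant summand of an entry. -/
def Entry.offset : Entry → ℕ
  | .lit c => c
  | .width => 0
  | .atSite c => c
  | .atCoin c => c

/-- The memory cell that holds the variable summand of an entry. -/
def Entry.cell : Entry → ℕ
  | .lit _ => 11
  | .width => 3
  | .atSite _ => 7
  | .atCoin _ => 9

/-- The state of the program: cell `0` is used for computations, cells `1` to `6` contain
constants, cells `7` and `9` the first wires of the current site and coin, and cells `8` and `10`
the numbers of sites and coins that remain. -/
def writer (n k v a i b j : ℕ) (out : List ℕ) : MState :=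
  machine [v, n, k, regWidth n k, 7 * (k + 3), 1, 7, a, i, b, j] out

/-- Write a list of entries on the output tape. -/
def emitProg : List Entry → Prog
  | [] => .const 0 0
  | e :: l => .seq (.const 0 e.offset) (.seq (.plus 0 e.cell) (.seq (.emit 0) (emitProg l)))

lemma runsTo_emitProg (l : List Entry) (v a i b j : ℕ) (out : List ℕ) :
    RunsTo (emitProg l) (writer n k v a i b j out)
      (writer n k 0 a i b j (out ++ l.map (Entry.value (regWidth n k) a b)))
      (3 * l.length + 1) := by
  induction l generalizing v out with
  | nil =>
    rw [List.map_nil, List.append_nil]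
    exact runsTo_const out (by simp) 0
  | cons e l ih =>
    have hvalue : e.offset + [e.offset, n, k, regWidth n k, 7 * (k + 3), 1, 7, a, i, b, j].getD
        e.cell 0 = e.value (regWidth n k) a b := by
      cases e <;> simp [Entry.offset, Entry.cell, Entry.value]
    have hplus : RunsTo (.plus 0 e.cell) (writer n k e.offset a i b j out)
        (writer n k (e.value (regWidth n k) a b) a i b j out) 1 :=
      hvalue ▸ runsTo_plus out (by simp) e.cell
    have hconst : RunsTo (.const 0 e.offset) (writer n k v a i b j out)
        (writer n k e.offset a i b j out) 1 := runsTo_const out (by simp) e.offset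
    rw [List.map_cons, List.append_cons]
    exact (hconst.seq (hplus.seq ((runsTo_emit out _ 0).seq (ih _ _)))).mono
      (by rw [List.length_cons]; lia)

/-- Write a list of entries for each coin of the current site. -/
def coinsProg (l : List Entry) : Prog :=
  .seq (.copy 9 7) (.seq (.copy 10 2) (.loop 10 (.seq (emitProg l)
    (.seq (.plus 9 6) (.minus 10 5)))))

/-- The output of `coinsProg` at a site whose first wire is `a`. -/
def coinsOut (n k : ℕ) (l : List Entry) (a : ℕ) : List ℕ :=
  (List.range k).flatMap fun j => l.map (Entry.value (regWidth n k) a (a + 7 * j))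

lemma runsTo_coinsProg (l : List Entry) (a i : ℕ) (out : List ℕ) :
    RunsTo (coinsProg l) (writer n k 0 a i 0 0 out)
      (writer n k 0 a i (a + 7 * k) 0 (out ++ coinsOut n k l a))
      (k * (3 * l.length + 4) + 3) := by
  let S (j : ℕ) : MState := writer n k 0 a i (a + 7 * j) (k - j) (out ++ (List.range j).flatMap
    fun j => l.map (Entry.value (regWidth n k) a (a + 7 * j)))
  have hbody (j : ℕ) : RunsTo (.seq (emitProg l) (.seq (.plus 9 6) (.minus 10 5))) (S j) (S (j + 1))
      (3 * l.length + 3) := by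
    have hplus (out' : List ℕ) : RunsTo (.plus 9 6) (writer n k 0 a i (a + 7 * j) (k - j) out')
        (writer n k 0 a i (a + 7 * (j + 1)) (k - j) out') 1 := runsTo_plus out' (by simp) 6
    simp only [S, List.range_succ, List.flatMap_append, List.flatMap_singleton, ← List.append_assoc]
    exact (runsTo_emitProg l 0 a i (a + 7 * j) (k - j) _).seq
      ((hplus _).seq (runsTo_minus _ (by simp) 5))
  have hloop := RunsTo.loop (r := 10) (N := k) (S := S)
    (fun j hj => ⟨Nat.sub_ne_zero_of_lt hj, hbody j⟩) (Nat.sub_self k)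
  have hsite : RunsTo (.copy 9 7) (writer n k 0 a i 0 0 out) (writer n k 0 a i a 0 out) 1 :=
    runsTo_copy out (by simp) 7
  have hcoin : RunsTo (.copy 10 2) (writer n k 0 a i a 0 out) (writer n k 0 a i a k out) 1 :=
    runsTo_copy out (by simp) 2
  have hS₀ : S 0 = writer n k 0 a i a k out := by simp [S]
  have hS : S k = writer n k 0 a i (a + 7 * k) 0 (out ++ coinsOut n k l a) := by
    simp [S, coinsOut]
  rw [hS₀, hS] at hloop
  exact (hsite.seq (hcoin.seq hloop)).mono (by lia)

/-- What the program writes down: `start` once, and for each site first `site`, then `coin` for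
each coin of the site that may start a run, then `close`. In `close`, the current coin is the one
after these. -/
structure Phase where
  start : List Entry
  site : List Entry
  coin : List Entry
  close : List Entry

/-- The output of a phase at a site whose first wire is `a`. -/
def Phase.siteOut (n k : ℕ) (P : Phase) (a : ℕ) : List ℕ :=
  P.site.map (Entry.value (regWidth n k) a 0) ++ coinsOut n k P.coin a ++
    P.close.map (Entry.value (regWidth n k) a (a + 7 * k))

/-- The output of a phase. -/
def Phase.out (n k : ℕ) (P : Phase) : List ℕ :=
  P.start.map (Entry.value (regWidth n k) 0 0) ++
    (List.range n).flatMap fun i => P.siteOut n k (7 * (k + 3) * i)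

/-- The part of the program for one site. -/
def Phase.siteProg (P : Phase) : Prog :=
  .seq (emitProg P.site) (.seq (coinsProg P.coin) (.seq (emitProg P.close)
    (.seq (.const 9 0) (.seq (.plus 7 4) (.minus 8 5)))))

/-- The part of the program for one phase. -/
def Phase.prog (P : Phase) : Prog :=
  .seq (emitProg P.start) (.seq (.copy 8 1) (.seq (.loop 8 P.siteProg) (.const 7 0)))

/-- A bound for the number of steps of a phase per site and coin. -/
def Phase.cost (P : Phase) : ℕ :=
  3 * (P.start.length + P.site.length + P.coin.length + P.close.length) + 13

lemma Phase.runsTo_siteProg (P : Phase) (a i : ℕ) (out : List ℕ) :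
    RunsTo P.siteProg (writer n k 0 a i 0 0 out)
      (writer n k 0 (a + 7 * (k + 3)) (i - 1) 0 0 (out ++ P.siteOut n k a))
      ((3 * (P.site.length + P.coin.length + P.close.length) + 8) * (k + 1)) := by
  have hclear (b : ℕ) (out' : List ℕ) :
      RunsTo (.const 9 0) (writer n k 0 a i b 0 out') (writer n k 0 a i 0 0 out') 1 :=
    runsTo_const out' (by simp) 0
  have hplus (out' : List ℕ) : RunsTo (.plus 7 4) (writer n k 0 a i 0 0 out')
      (writer n k 0 (a + 7 * (k + 3)) i 0 0 out') 1 := runsTo_plus out' (by simp) 4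
  have hminus (out' : List ℕ) : RunsTo (.minus 8 5) (writer n k 0 (a + 7 * (k + 3)) i 0 0 out')
      (writer n k 0 (a + 7 * (k + 3)) (i - 1) 0 0 out') 1 := runsTo_minus out' (by simp) 5
  rw [siteOut, ← List.append_assoc, ← List.append_assoc]
  exact ((runsTo_emitProg P.site 0 a i 0 0 out).seq ((runsTo_coinsProg P.coin a i _).seq
    ((runsTo_emitProg P.close 0 a i (a + 7 * k) 0 _).seq ((hclear _ _).seq
      ((hplus _).seq (hminus _)))))).mono (by nlinarith)

lemma Phase.runsTo_prog (P : Phase) (out : List ℕ) :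
    RunsTo P.prog (writer n k 0 0 0 0 0 out) (writer n k 0 0 0 0 0 (out ++ P.out n k))
      (P.cost * ((n + 1) * (k + 1))) := by
  let S (i : ℕ) : MState := writer n k 0 (7 * (k + 3) * i) (n - i) 0 0
    (out ++ P.start.map (Entry.value (regWidth n k) 0 0) ++
      (List.range i).flatMap fun i => P.siteOut n k (7 * (k + 3) * i))
  have hbody (i : ℕ) : RunsTo P.siteProg (S i) (S (i + 1))
      ((3 * (P.site.length + P.coin.length + P.close.length) + 8) * (k + 1)) := by
    simp only [S, List.range_succ, List.flatMap_append, List.flatMap_singleton, ← List.append_assoc]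
    exact P.runsTo_siteProg (7 * (k + 3) * i) (n - i) _
  have hloop := RunsTo.loop (r := 8) (N := n) (S := S)
    (fun i hi => ⟨Nat.sub_ne_zero_of_lt hi, hbody i⟩) (Nat.sub_self n)
  have hcopy (out' : List ℕ) : RunsTo (.copy 8 1) (writer n k 0 0 0 0 0 out')
      (writer n k 0 0 n 0 0 out') 1 := runsTo_copy out' (by simp) 1
  have hclear (a : ℕ) (out' : List ℕ) :
      RunsTo (.const 7 0) (writer n k 0 a 0 0 0 out') (writer n k 0 0 0 0 0 out') 1 :=
    runsTo_const out' (by simp) 0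
  have hS₀ : S 0 = writer n k 0 0 n 0 0 (out ++ P.start.map (Entry.value (regWidth n k) 0 0)) := by
    simp [S]
  have hS : S n = writer n k 0 (7 * (k + 3) * n) 0 0 0 (out ++ P.out n k) := by
    simp [S, Phase.out]
  rw [hS₀, hS] at hloop
  refine ((runsTo_emitProg P.start 0 0 0 0 0 out).seq ((hcopy _).seq (hloop.seq
    (hclear _ _)))).mono ?_
  set m := (n + 1) * (k + 1)
  have hnk : n * (k + 1) ≤ m := Nat.mul_le_mul_right _ n.le_succ
  have hn : n + 1 ≤ m := Nat.le_mul_of_pos_right _ k.succ_pos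
  set L := 3 * (P.site.length + P.coin.length + P.close.length) + 8 with hL
  calc _ = 3 * P.start.length * 1 + L * (n * (k + 1)) + (n + 4 * 1) := by ring
    _ ≤ 3 * P.start.length * m + L * m + (m + 4 * m) := by gcongr <;> lia
    _ = P.cost * m := by rw [Phase.cost, hL]; ring

/-- The program that runs through a list of phases. -/
def phasesProg : List Phase → Prog
  | [] => .const 0 0
  | P :: Ps => .seq P.prog (phasesProg Ps)

lemma runsTo_phasesProg (Ps : List Phase) (out : List ℕ) :
    RunsTo (phasesProg Ps) (writer n k 0 0 0 0 0 out)
      (writer n k 0 0 0 0 0 (out ++ Ps.flatMap (Phase.out n k)))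
      ((Ps.map Phase.cost).sum * ((n + 1) * (k + 1)) + 1) := by
  induction Ps generalizing out with
  | nil =>
    rw [List.flatMap_nil, List.append_nil]
    exact (runsTo_const out (by simp) 0).mono (by lia)
  | cons P Ps ih =>
    rw [List.flatMap_cons, ← List.append_assoc, List.map_cons, List.sum_cons, Nat.add_mul,
      Nat.add_assoc]
    exact (P.runsTo_prog out).seq (ih _)

/-! ### The description of the swap test -/

/-- The description of an operation, as in `Circuit.encode`. -/
def encodeGate {m : ℕ} (g : Gate n m) : List ℕ :=
  g.kind.code :: List.ofFn fun i => (g.wires i : ℕ)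

lemma encodeGate_gateH {m : ℕ} (t : Fin m) : encodeGate (gateH n t) = [1, (t : ℕ)] := rfl

section ClassicalGate

variable {m : ℕ} {a b t : Fin m}

lemma encodeGate_not : encodeGate ((ClassicalGate.not t).toGate n) = [0, (t : ℕ)] := rfl

lemma encodeGate_cnot (h : a ≠ t) :
    encodeGate ((ClassicalGate.cnot a t h).toGate n) = [3, (a : ℕ), (t : ℕ)] := rfl

lemma encodeGate_toffoli (h : a ≠ b ∧ a ≠ t ∧ b ≠ t) :
    encodeGate ((ClassicalGate.toffoli a b t h).toGate n) = [4, (a : ℕ), (b : ℕ), (t : ℕ)] := rfl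

end ClassicalGate

/-- The width, the measured wire, and the coin tosses. -/
def tossPhase : Phase where
  start := [.width, .lit 5]
  site := []
  coin := [.lit 1, .atCoin 0]
  close := [.lit 1, .atCoin 0, .lit 1, .atCoin 7, .lit 1, .atCoin 14]

/-- The gates `markGates`. -/
def markPhase : Phase where
  start := []
  site := [.lit 3, .atSite 7, .atSite 2, .lit 3, .atSite 14, .atSite 3, .lit 0, .atSite 1]
  coin := [.lit 4, .atCoin 1, .atCoin 21, .atCoin 8]
  close := [.lit 3, .atCoin 1, .atCoin 25, .lit 4, .atSite 0, .atSite 4, .atCoin 25]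

/-- A gate with the given entries, followed by the gates `swapGates`. -/
def swapPhase (start : List Entry) : Phase where
  start := start
  site := []
  coin := []
  close := [.lit 4, .lit 5, .atCoin 25, .lit 6, .lit 3, .atSite 3, .atSite 2,
    .lit 4, .lit 6, .atSite 2, .atSite 3, .lit 3, .atSite 3, .atSite 2,
    .lit 4, .lit 5, .atCoin 25, .lit 6]

/-- A query at the wires at the given distance from the first wires of the sites. -/
def queryPhase (c : ℕ) : Phase := ⟨[.lit 5], [.atSite c], [], []⟩

/-- The phases in which the swap test is written down. -/
def swapTestPhases : List Phase :=
  [tossPhase, markPhase, swapPhase [.lit 1, .lit 5], queryPhase 2, queryPhase 3,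
    swapPhase [.lit 0, .lit 5], ⟨[.lit 1, .lit 5], [], [], []⟩]

lemma flatMap_range {α : Type*} (l : ℕ) (f : ℕ → List α) :
    (List.range l).flatMap f = (List.finRange l).flatMap fun i : Fin l => f i := by
  rw [← List.map_coe_finRange_eq_range, List.flatMap_map]

lemma coinsOut_nil (a : ℕ) : coinsOut n k [] a = [] := by
  simp [coinsOut]

lemma out_tossPhase : tossPhase.out n k =
    [regWidth n k, (ctlWire n k : ℕ)] ++ (tossGates n k).flatMap encodeGate := by
  have hgate (p : Fin (n * (k + 3))) : encodeGate (gateH n (coinWire (k := k)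
      (finProdFinEquiv.symm p).1 (finProdFinEquiv.symm p).2)) = [1, 7 * (p : ℕ)] := by
    have hp : wire (k := k) (finProdFinEquiv.symm p).1.castSucc (finProdFinEquiv.symm p).2 0 =
        (7 * p : ℕ) := by
      rw [val_wire, Fin.val_zero, Nat.zero_add, Fin.val_castSucc]
      exact congrArg (7 * ·) (congrArg Fin.val (finProdFinEquiv.apply_symm_apply p))
    rw [encodeGate_gateH, hp]
  have hwire (i j : ℕ) : 7 * (i * (k + 3) + j) = 7 * (k + 3) * i + 7 * j := by ring
  have htoss : (tossGates n k).flatMap encodeGate =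
      (List.range n).flatMap fun i => (List.range (k + 3)).flatMap fun j =>
        [1, 7 * (k + 3) * i + 7 * j] := by
    simp_rw [tossGates, flatMap_range, List.flatMap_def, ← List.ofFn_eq_map, List.map_ofFn,
      Function.comp_def, hgate, List.ofFn_mul, List.flatten_flatten, List.map_ofFn,
      Function.comp_def, hwire]
  rw [htoss]
  simp only [List.range_succ, List.flatMap_append, List.flatMap_singleton]
  refine congrArg (fun f => _ ++ List.flatMap f _) (funext fun i => ?_)
  simp [tossPhase, Phase.siteOut, coinsOut, Entry.value]
  ring_nf
  simp

lemma out_markPhase : markPhase.out n k =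
    ((markGates n k).map (ClassicalGate.toGate n)).flatMap encodeGate := by
  rw [markGates, List.map_flatMap, List.flatMap_assoc, Phase.out, flatMap_range]
  refine congrArg (List.flatMap · _) (funext fun i => ?_)
  simp only [Phase.siteOut, coinsOut, flatMap_range, siteMarkGates, markPhase]
  simp [encodeGate_not, encodeGate_cnot, encodeGate_toffoli, val_wire, List.flatMap_map,
    Entry.value, Nat.mod_eq_of_lt (show 2 < k + 3 by lia)]
  ring_nf
  simp

lemma out_swapPhase (start : List Entry) : (swapPhase start).out n k =
    start.map (Entry.value (regWidth n k) 0 0) ++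
      ((swapGates n k).map (ClassicalGate.toGate n)).flatMap encodeGate := by
  rw [swapGates, List.map_flatMap, List.flatMap_assoc, Phase.out, flatMap_range]
  refine congrArg (fun f => start.map _ ++ List.flatMap f _) (funext fun i => ?_)
  simp [Phase.siteOut, coinsOut_nil, swapPhase, siteSwapGates, encodeGate_cnot, encodeGate_toffoli,
    val_wire, Entry.value]
  ring_nf
  simp

lemma out_queryPhase :
    (queryPhase 2).out n k ++ (queryPhase 3).out n k = (queryGates n k).flatMap encodeGate := by
  have hout (c : ℕ) : (queryPhase c).out n k = 5 :: List.ofFn fun i : Fin n =>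
      c + 7 * ((k + 3) * (i : ℕ)) := by
    rw [List.ofFn_eq_map, Phase.out, flatMap_range]
    simp [queryPhase, Phase.siteOut, coinsOut_nil, Entry.value, List.map_eq_flatMap, mul_assoc]
  simp [hout, queryGates, encodeGate, val_wire, GateKind.code]

lemma encode_swapCircuit (n k : ℕ) :
    (swapCircuit n k).encode = swapTestPhases.flatMap (Phase.out n k) := by
  change regWidth n k :: (ctlWire n k : ℕ) :: (swapCircuitGates n k).flatMap encodeGate = _
  have hH : (⟨[.lit 1, .lit 5], [], [], []⟩ : Phase).out n k =
      encodeGate (gateH n (ctlWire n k)) := by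
    simp [Phase.out, Phase.siteOut, coinsOut_nil, Entry.value, encodeGate_gateH, val_wire]
  have hquery (l : List ℕ) : (queryPhase 2).out n k ++ ((queryPhase 3).out n k ++ l) =
      (queryGates n k).flatMap encodeGate ++ l := by
    rw [← List.append_assoc, out_queryPhase]
  simp only [swapCircuitGates, testGates, swapTestPhases, List.flatMap_cons, List.flatMap_nil,
    List.flatMap_append, out_tossPhase, out_markPhase, out_swapPhase, hquery, hH, encodeGate_gateH,
    encodeGate_not, val_wire]
  simp [Entry.value]

/-! ### The program for the swap test -/

/-- Compute the number `k` of coins. -/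
def coinCountProg : Prog :=
  .seq (.copy 1 0) (.seq (.const 5 1) (.seq (.const 6 7) (.seq (.const 2 1) (.seq (.const 7 1)
    (.seq (.copy 8 1) (.seq (.minus 8 7) (.loop 8 (.seq (.plus 7 7) (.seq (.plus 2 5)
      (.seq (.copy 8 1) (.minus 8 7)))))))))))

lemma runsTo_coinCountProg (n : ℕ) :
    RunsTo coinCountProg (MState.init n)
      (machine [n, n, coinCount n, 0, 0, 1, 7, 2 ^ Nat.clog 2 n, 0, 0, 0] [])
      (5 * Nat.clog 2 n + 8) := by
  let S (j : ℕ) : MState := machine [n, n, j + 1, 0, 0, 1, 7, 2 ^ j, n - 2 ^ j, 0, 0] []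
  have hinit : MState.init n = machine [n, 0, 0, 0, 0, 0, 0, 0, 0, 0, 0] [] := by
    refine congrArg (MState.mk · []) (funext fun r => ?_)
    rcases lt_or_ge r 11 with hr | hr
    · interval_cases r <;> rfl
    · simp [show r ≠ 0 by lia, hr]
  have hbody (j : ℕ) : RunsTo (.seq (.plus 7 7) (.seq (.plus 2 5) (.seq (.copy 8 1) (.minus 8 7))))
      (S j) (S (j + 1)) 4 := by
    have h := (runsTo_plus (cells := [n, n, j + 1, 0, 0, 1, 7, 2 ^ j, n - 2 ^ j, 0, 0])
      [] (r := 7) (by simp) 7).seq ((runsTo_plus [] (r := 2) (by simp) 5).seq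
        ((runsTo_copy [] (r := 8) (by simp) 1).seq (runsTo_minus [] (r := 8) (by simp) 7)))
    simpa [S, pow_succ, mul_two] using h
  have hloop := RunsTo.loop (r := 8) (N := Nat.clog 2 n) (S := S)
    (fun j hj => ⟨Nat.sub_ne_zero_of_lt ((Nat.lt_clog_iff_pow_lt one_lt_two).1 hj), hbody j⟩)
    (Nat.sub_eq_zero_of_le (Nat.le_pow_clog one_lt_two n))
  have hstart := (runsTo_copy (cells := [n, 0, 0, 0, 0, 0, 0, 0, 0, 0, 0]) [] (r := 1) (by simp)
    0).seq ((runsTo_const [] (r := 5) (by simp) 1).seq ((runsTo_const [] (r := 6) (by simp) 7).seq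
      ((runsTo_const [] (r := 2) (by simp) 1).seq ((runsTo_const [] (r := 7) (by simp) 1).seq
        ((runsTo_copy [] (r := 8) (by simp) 1).seq ((runsTo_minus [] (r := 8) (by simp) 7).seq
          hloop))))))
  have hend : S (Nat.clog 2 n) =
      machine [n, n, coinCount n, 0, 0, 1, 7, 2 ^ Nat.clog 2 n, 0, 0, 0] [] := by
    simp [S, coinCount, Nat.sub_eq_zero_of_le (Nat.le_pow_clog one_lt_two n)]
  rw [hinit, ← hend]
  exact hstart.mono (by lia)

/-- Compute the distance between the rows of the register. -/
def strideProg : Prog :=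
  .seq (.const 4 3) (.seq (.plus 4 2) (.seq (.copy 0 4) (.seq (.plus 4 4) (.seq (.plus 4 0)
    (.seq (.plus 4 4) (.plus 4 0))))))

lemma runsTo_strideProg (n k a : ℕ) :
    RunsTo strideProg (machine [n, n, k, 0, 0, 1, 7, a, 0, 0, 0] [])
      (machine [k + 3, n, k, 0, 7 * (k + 3), 1, 7, a, 0, 0, 0] []) 7 := by
  have h := (runsTo_const (cells := [n, n, k, 0, 0, 1, 7, a, 0, 0, 0]) [] (r := 4) (by simp)
    3).seq ((runsTo_plus [] (r := 4) (by simp) 2).seq ((runsTo_copy [] (r := 0) (by simp) 4).seq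
      ((runsTo_plus [] (r := 4) (by simp) 4).seq ((runsTo_plus [] (r := 4) (by simp) 0).seq
        ((runsTo_plus [] (r := 4) (by simp) 4).seq (runsTo_plus [] (r := 4) (by simp) 0))))))
  have hstride : 3 + k + (3 + k) + (3 + k) + (3 + k + (3 + k) + (3 + k)) + (3 + k) =
      7 * (k + 3) := by ring
  simpa [strideProg, hstride, add_comm k 3] using h

/-- Compute the number of wires. -/
def widthProg : Prog :=
  .seq (.copy 3 4) (.seq (.copy 8 1) (.seq (.loop 8 (.seq (.plus 3 4) (.minus 8 5)))
    (.seq (.const 7 0) (.const 0 0))))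

lemma runsTo_widthProg (n k v a : ℕ) :
    RunsTo widthProg (machine [v, n, k, 0, 7 * (k + 3), 1, 7, a, 0, 0, 0] [])
      (writer n k 0 0 0 0 0 []) (3 * n + 5) := by
  set s := 7 * (k + 3) with hs
  let S (i : ℕ) : MState := machine [v, n, k, s + s * i, s, 1, 7, a, n - i, 0, 0] []
  have hbody (i : ℕ) : RunsTo (.seq (.plus 3 4) (.minus 8 5)) (S i) (S (i + 1)) 2 := by
    have h := (runsTo_plus (cells := [v, n, k, s + s * i, s, 1, 7, a, n - i, 0, 0])
      [] (r := 3) (by simp) 4).seq (runsTo_minus [] (r := 8) (by simp) 5)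
    simpa [S, mul_add, add_assoc, Nat.sub_sub] using h
  have hloop := RunsTo.loop (r := 8) (N := n) (S := S)
    (fun i hi => ⟨Nat.sub_ne_zero_of_lt hi, hbody i⟩) (Nat.sub_self n)
  have hend : RunsTo (.seq (.const 7 0) (.const 0 0)) (S n) (writer n k 0 0 0 0 0 []) 2 := by
    have h := (runsTo_const (cells := [v, n, k, s + s * n, s, 1, 7, a, n - n, 0, 0])
      [] (r := 7) (by simp) 0).seq (runsTo_const [] (r := 0) (by simp) 0)
    have hwidth : s + s * n = regWidth n k := by rw [hs, regWidth]; ring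
    simpa [S, writer, hwidth, ← hs] using h
  have hstart : RunsTo (.copy 3 4) (machine [v, n, k, 0, s, 1, 7, a, 0, 0, 0] [])
      (machine [v, n, k, s, s, 1, 7, a, 0, 0, 0] []) 1 := runsTo_copy [] (by simp) 4
  have hsites : RunsTo (.copy 8 1) (machine [v, n, k, s, s, 1, 7, a, 0, 0, 0] []) (S 0) 1 :=
    runsTo_copy [] (by simp) 1
  exact (hstart.seq (hsites.seq (hloop.seq hend))).mono (by lia)

/-- The program that writes down the swap test. -/
def swapTestProg : Prog :=
  .seq coinCountProg (.seq strideProg (.seq widthProg (phasesProg swapTestPhases)))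

lemma coinCount_le (n : ℕ) : coinCount n ≤ n + 1 :=
  Nat.succ_le_succ (Nat.clog_le_of_le_pow Nat.lt_two_pow_self.le)

lemma runsTo_swapTestProg (n : ℕ) :
    RunsTo swapTestProg (MState.init n)
      (writer n (coinCount n) 0 0 0 0 0 (swapCircuit n (coinCount n)).encode)
      (((swapTestPhases.map Phase.cost).sum + 21) * ((n + 1) * (n + 2))) := by
  have h := (runsTo_coinCountProg n).seq ((runsTo_strideProg n _ _).seq
    ((runsTo_widthProg n _ _ _).seq (runsTo_phasesProg swapTestPhases [])))
  rw [List.nil_append, ← encode_swapCircuit] at h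
  refine h.mono ?_
  have hk := coinCount_le n
  have hclog : Nat.clog 2 n ≤ n + 1 := (Nat.le_succ _).trans hk
  have hcost : (swapTestPhases.map Phase.cost).sum * ((n + 1) * (coinCount n + 1)) ≤
      (swapTestPhases.map Phase.cost).sum * ((n + 1) * (n + 2)) :=
    Nat.mul_le_mul_left _ (Nat.mul_le_mul_left _ (by lia))
  rw [Nat.add_mul]
  nlinarith

/-- The swap test, with the number of coins for which runs of marked sites start with
probability of order `1 / n`. -/
def swapExperiment : Experiment := fun n => swapCircuit n (coinCount n)

lemma swapExperiment_polyTime : swapExperiment.PolyTime := by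
  refine ⟨swapTestProg, .C ((swapTestPhases.map Phase.cost).sum + 21) *
    ((.X + .C 1) * (.X + .C 2)), fun n => ?_⟩
  obtain ⟨t, ht, h⟩ := runsTo_swapTestProg n
  simp only [Polynomial.eval_mul, Polynomial.eval_add, Polynomial.eval_C, Polynomial.eval_X]
  refine ⟨?_, _, t, h, ht, rfl⟩
  have hk := coinCount_le n
  calc regWidth n (coinCount n) ≤ 28 * ((n + 1) * (n + 2)) := by rw [regWidth]; nlinarith
    _ ≤ _ := Nat.mul_le_mul_right _ (by decide)

/-! ### The distinguishing signal -/

/-- The nontrivial Pauli strings within `w`. The identity string is left out because it contributes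
the same to every unitary. -/
def nontrivialWithin (w : Bits n) : Finset (PauliString n) :=
  {P | PauliString.Within w P ∧ P ≠ PauliString.one n}

lemma mem_nontrivialWithin {w : Bits n} {P : PauliString n} :
    P ∈ nontrivialWithin w ↔ PauliString.Within w P ∧ P ≠ PauliString.one n := by
  simp [nontrivialWithin]

/-- The part of the rejection probability of the swap test (doubled, and averaged over the marks)
that depends on `U`. -/
def signal (k : ℕ) (U : UGroup n) : ℝ :=
  ∑ w : Bits n, markProb k w * (1 / 4) ^ weight w *
    ∑ p ∈ nontrivialWithin w ×ˢ nontrivialWithin w, transfer p.1 p.2 U ^ 2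

lemma transferSum_eq_one_add (w : Bits n) (U : UGroup n) : transferSum w U =
    1 + ∑ p ∈ nontrivialWithin w ×ˢ nontrivialWithin w, transfer p.1 p.2 U ^ 2 := by
  have hwithin : (Finset.univ.filter (PauliString.Within w)) =
      insert (PauliString.one n) (nontrivialWithin w) := by
    ext P
    by_cases hP : P = PauliString.one n <;>
      simp [mem_nontrivialWithin, hP, PauliString.Within, PauliString.one]
  have hone : PauliString.one n ∉ nontrivialWithin w := fun h => (mem_nontrivialWithin.mp h).2 rfl
  have hleft : ∑ Q ∈ nontrivialWithin w, transfer (PauliString.one n) Q U ^ 2 = 0 :=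
    Finset.sum_eq_zero fun Q hQ => by
      simp [transfer_one_left, (mem_nontrivialWithin.mp hQ).2]
  simp only [transferSum, hwithin, Finset.sum_insert hone, hleft, transfer_one_right, if_true,
    Finset.sum_product]
  norm_num
  exact Finset.sum_congr rfl fun P hP => by simp [(mem_nontrivialWithin.mp hP).2]

lemma acceptProb_swapCircuit_eq_sub_signal (k : ℕ) (U : UGroup n) :
    (swapCircuit n k).acceptProb U =
      1 / 2 * ∑ w : Bits n, markProb k w * (1 - (1 / 4) ^ weight w) - 1 / 2 * signal k U := by
  rw [acceptProb_swapCircuit, signal, ← mul_sub, ← Finset.sum_sub_distrib]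
  congr 1
  refine Finset.sum_congr rfl fun w _ => ?_
  rw [transferSum_eq_one_add]
  ring

lemma integrable_transfer_sq (P Q : PauliString n) (μ : Measure (UGroup n)) [IsFiniteMeasure μ] :
    Integrable (fun U => transfer P Q U ^ 2) μ :=
  ((continuous_transfer P Q).pow 2).integrable_of_hasCompactSupport (.of_compactSpace _)

lemma continuous_signal (k : ℕ) : Continuous (signal (n := n) k) :=
  continuous_finsetSum _ fun _ _ => continuous_const.mul
    (continuous_finsetSum _ fun p _ => (continuous_transfer p.1 p.2).pow 2)

lemma integrable_signal (k : ℕ) (μ : Measure (UGroup n)) [IsFiniteMeasure μ] :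
    Integrable (signal k) μ :=
  (continuous_signal k).integrable_of_hasCompactSupport (.of_compactSpace _)

lemma integral_acceptProb_swapCircuit (k : ℕ) (μ : Measure (UGroup n)) [IsProbabilityMeasure μ] :
    ∫ U, (swapCircuit n k).acceptProb U ∂μ =
      1 / 2 * ∑ w : Bits n, markProb k w * (1 - (1 / 4) ^ weight w) -
        1 / 2 * ∫ U, signal k U ∂μ := by
  simp only [acceptProb_swapCircuit_eq_sub_signal]
  rw [integral_sub (integrable_const _) ((integrable_signal k μ).const_mul _), integral_const,
    integral_const_mul]
  simp

lemma advantage_swapExperiment (E : (n : ℕ) → Measure (UGroup n)) [∀ n, IsProbabilityMeasure (E n)]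
    (n : ℕ) : advantage swapExperiment E n =
      1 / 2 * |∫ U, signal (coinCount n) U ∂(E n) - ∫ U, signal (coinCount n) U ∂(haar n)| := by
  have hsub (c x y : ℝ) : |(c - 1 / 2 * x) - (c - 1 / 2 * y)| = 1 / 2 * |x - y| := by
    rw [sub_sub_sub_cancel_left, ← mul_sub, abs_mul, abs_sub_comm]
    norm_num
  simp only [advantage, swapExperiment, integral_acceptProb_swapCircuit, hsub]

lemma card_filter_within (w : Bits n) :
    (Finset.univ.filter (PauliString.Within w)).card = 4 ^ weight w := by
  have hind (P : PauliString n) : (if PauliString.Within w P then 1 else 0) =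
      ∏ i, if w i = 0 → P i = .I then 1 else 0 := by
    rw [Finset.prod_ite_zero, Finset.prod_const_one]
    congr 1
    simp [PauliString.Within]
  have hsite (u : Fin 2) : (∑ a : Pauli, if u = 0 → a = .I then 1 else 0) = 4 ^ (u : ℕ) := by
    revert u
    decide
  rw [Finset.card_filter, Finset.sum_congr rfl fun P _ => hind P,
    sum_prod_eq_prod_sum fun i a => if w i = 0 → a = Pauli.I then 1 else 0]
  simp only [hsite, Finset.prod_pow_eq_pow_sum, weight]

lemma card_nontrivialWithin_le (w : Bits n) : (nontrivialWithin w).card ≤ 4 ^ weight w := by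
  rw [← card_filter_within w]
  exact Finset.card_le_card fun P hP => by simp [(mem_nontrivialWithin.mp hP).1]

lemma integral_signal_haar_le (hk : 1 ≤ k) : ∫ U, signal k U ∂(haar n) ≤ 2 * (5 / 8) ^ n := by
  have hw (w : Bits n) : ∑ p ∈ nontrivialWithin w ×ˢ nontrivialWithin w,
      ∫ U, transfer p.1 p.2 U ^ 2 ∂(haar n) ≤ 4 ^ weight w * 4 ^ weight w * (2 / 4 ^ n) := by
    have hcard : ((nontrivialWithin w).card : ℝ) ≤ 4 ^ weight w :=
      mod_cast card_nontrivialWithin_le w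
    calc _ ≤ ∑ p ∈ nontrivialWithin w ×ˢ nontrivialWithin w, (2 / 4 ^ n : ℝ) :=
          Finset.sum_le_sum fun p hp => integral_transfer_sq_le
            (mem_nontrivialWithin.mp (Finset.mem_product.mp hp).1).2 p.2
      _ = (nontrivialWithin w).card * (nontrivialWithin w).card * (2 / 4 ^ n) := by simp
      _ ≤ _ := by gcongr
  calc ∫ U, signal k U ∂(haar n)
      = ∑ w : Bits n, markProb k w * (1 / 4) ^ weight w *
          ∑ p ∈ nontrivialWithin w ×ˢ nontrivialWithin w,
            ∫ U, transfer p.1 p.2 U ^ 2 ∂(haar n) := by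
        have hint (w : Bits n) : Integrable (fun U => ∑ p ∈ nontrivialWithin w ×ˢ
            nontrivialWithin w, transfer p.1 p.2 U ^ 2) (haar n) :=
          integrable_finsetSum _ fun p _ => integrable_transfer_sq p.1 p.2 _
        simp only [signal]
        rw [integral_finsetSum _ fun w _ => (hint w).const_mul _]
        refine Finset.sum_congr rfl fun w _ => ?_
        rw [integral_const_mul,
          integral_finsetSum _ fun p _ => integrable_transfer_sq p.1 p.2 _]
    _ ≤ ∑ w : Bits n, markProb k w * (1 / 4) ^ weight w *
          (4 ^ weight w * 4 ^ weight w * (2 / 4 ^ n)) :=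
        Finset.sum_le_sum fun w _ => mul_le_mul_of_nonneg_left (hw w)
          (mul_nonneg (markProb_nonneg _ _) (by positivity))
    _ = 2 / 4 ^ n * ∑ w : Bits n, markProb k w * 4 ^ weight w := by
        rw [Finset.mul_sum]
        refine Finset.sum_congr rfl fun w _ => ?_
        rw [one_div, inv_pow]
        field_simp
    _ ≤ 2 / 4 ^ n * (5 / 2) ^ n := by
        gcongr
        exact sum_markProb_mul_four_pow_le hk
    _ = 2 * (5 / 8) ^ n := by
        rw [div_mul_eq_mul_div, mul_div_assoc, ← div_pow]
        norm_num

lemma mul_sum_le_sum_mul_sum_of_cover {ι α : Type*} [Fintype ι] {m : ι → ℝ}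
    {N : ι → Finset α} {s : Finset α} {f : α → ℝ} {δ : ℝ} (hm : ∀ i, 0 ≤ m i)
    (hf : ∀ x, 0 ≤ f x) (hcover : ∀ x ∈ s, ∃ i, x ∈ N i ∧ δ ≤ m i) :
    δ * ∑ x ∈ s, f x ≤ ∑ i, m i * ∑ x ∈ N i, f x := by
  classical
  have hpoint {x : α} (hx : x ∈ s) : δ ≤ ∑ i, if x ∈ N i then m i else 0 := by
    obtain ⟨i, hxi, hi⟩ := hcover x hx
    have hle := Finset.single_le_sum (f := fun i => if x ∈ N i then m i else 0)
      (fun i _ => by split_ifs <;> simp [hm i]) (Finset.mem_univ i)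
    rw [if_pos hxi] at hle
    exact hi.trans hle
  calc δ * ∑ x ∈ s, f x ≤ ∑ x ∈ s, (∑ i, if x ∈ N i then m i else 0) * f x := by
        rw [Finset.mul_sum]
        exact Finset.sum_le_sum fun x hx => mul_le_mul_of_nonneg_right (hpoint hx) (hf x)
    _ = ∑ i, m i * ∑ x ∈ s with x ∈ N i, f x := by
        simp only [Finset.sum_mul, Finset.mul_sum, Finset.sum_filter]
        rw [Finset.sum_comm]
        simp only [ite_mul, mul_ite, zero_mul, mul_zero]
    _ ≤ _ := Finset.sum_le_sum fun i _ => mul_le_mul_of_nonneg_left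
        (Finset.sum_le_sum_of_subset_of_nonneg (fun x hx => (Finset.mem_filter.mp hx).2)
          fun x _ _ => hf x) (hm i)

/-! ### Clustered Pauli strings -/

/-- The Pauli string acts non-trivially on at most `l` sites that form at most `b` intervals; more
precisely, it is trivial outside such a set of sites. Geometric locality bounds `l` with `b = 2`,
and a bound on the weight bounds both. -/
def IsClustered (b l : ℕ) (P : PauliString n) : Prop :=
  ∃ w : Bits n, PauliString.Within w P ∧ weight w ≤ l ∧ runs w ≤ b

lemma IsClustered.mono {b b' l l' : ℕ} {P : PauliString n}
    (hP : IsClustered b l P) (hb : b ≤ b') (hl : l ≤ l') :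
    IsClustered b' l' P := by
  obtain ⟨w, hPw, hweight, hruns⟩ := hP
  exact ⟨w, hPw, hweight.trans hl, hruns.trans hb⟩

lemma runs_le_weight (w : Bits n) : runs w ≤ weight w := by
  rw [runs, Finset.card_filter, weight]
  refine Finset.sum_le_sum fun i _ => ?_
  split_ifs with h
  · simp [h.1]
  · exact Nat.zero_le _

lemma weight_sup_le (v w : Bits n) : weight (v ⊔ w) ≤ weight v + weight w := by
  rw [weight, weight, weight, ← Finset.sum_add_distrib]
  refine Finset.sum_le_sum fun i _ => ?_
  rw [Pi.sup_apply]
  generalize v i = a, w i = b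
  revert a b
  decide

lemma prevMark_sup (v w : Bits n) (i : Fin n) :
    prevMark (v ⊔ w) i = prevMark v i ⊔ prevMark w i := by
  unfold prevMark
  cases h : i.castSucc using Fin.cases <;> simp

lemma runs_sup_le (v w : Bits n) : runs (v ⊔ w) ≤ runs v + runs w := by
  refine le_trans (Finset.card_le_card fun i hi => ?_) (Finset.card_union_le _ _)
  simp only [Finset.mem_filter, Finset.mem_univ, true_and, Finset.mem_union, Pi.sup_apply,
    prevMark_sup] at hi ⊢
  generalize v i = a, w i = b, prevMark v i = a', prevMark w i = b' at hi ⊢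
  revert a b a' b'
  decide

lemma IsClustered.exists_within {b l : ℕ} {P Q : PauliString n}
    (hP : IsClustered b l P) (hQ : IsClustered b l Q) :
    ∃ w : Bits n, PauliString.Within w P ∧ PauliString.Within w Q ∧ weight w ≤ 2 * l ∧
      runs w ≤ 2 * b := by
  obtain ⟨v, hPv, hvl, hvb⟩ := hP
  obtain ⟨w, hQw, hwl, hwb⟩ := hQ
  have hzero (i : Fin n) (h : (v ⊔ w) i = 0) : v i = 0 ∧ w i = 0 :=
    max_eq_bot.mp h
  exact ⟨v ⊔ w, fun i hi => hPv i (hzero i hi).1, fun i hi => hQw i (hzero i hi).2,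
    (weight_sup_le v w).trans (by omega), (runs_sup_le v w).trans (by omega)⟩

/-- The marks of a set of sites. -/
def marksOf (A : Finset (Fin n)) : Bits n := fun i => if i ∈ A then 1 else 0

lemma marksOf_eq_one {A : Finset (Fin n)} {i : Fin n} : marksOf A i = 1 ↔ i ∈ A := by
  simp [marksOf]

lemma marksOf_eq_zero {A : Finset (Fin n)} {i : Fin n} : marksOf A i = 0 ↔ i ∉ A := by
  simp [marksOf]

lemma weight_marksOf (A : Finset (Fin n)) : weight (marksOf A) = A.card := by
  simp [weight, marksOf, apply_ite Fin.val]

lemma within_marksOf {A : Finset (Fin n)} {P : PauliString n} (h : ∀ i, P i ≠ .I → i ∈ A) :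
    PauliString.Within (marksOf A) P :=
  fun i hi => of_not_not fun hP => marksOf_eq_zero.mp hi (h i hP)

lemma isClustered_of_weight_le {q : ℕ} {P : PauliString n}
    (h : PauliString.weight P ≤ q) : IsClustered q q P := by
  have hweight : weight (marksOf (Finset.univ.filter fun i => P i ≠ .I)) ≤ q :=
    (weight_marksOf _).trans_le h
  exact ⟨_, within_marksOf (by simp), hweight, (runs_le_weight _).trans hweight⟩

/-- A window of `q` consecutive sites, starting at `a`, of the ring of `n` sites. -/
def window (n q a : ℕ) : Finset (Fin n) := {i | ∃ j < q, (i : ℕ) = (a + j) % n}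

lemma mem_window {q a : ℕ} {i : Fin n} :
    i ∈ window n q a ↔ ∃ j < q, (i : ℕ) = (a + j) % n := by
  simp [window]

lemma card_window_le (n q a : ℕ) : (window n q a).card ≤ q := by
  have hsub : (window n q a).image Fin.val ⊆ (Finset.range q).image fun j => (a + j) % n := by
    intro x hx
    obtain ⟨i, hi, rfl⟩ := Finset.mem_image.mp hx
    obtain ⟨j, hj, hij⟩ := mem_window.mp hi
    exact Finset.mem_image.mpr ⟨j, Finset.mem_range.mpr hj, hij.symm⟩
  calc (window n q a).card = ((window n q a).image Fin.val).card :=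
        (Finset.card_image_of_injective _ Fin.val_injective).symm
    _ ≤ _ := Finset.card_le_card hsub
    _ ≤ (Finset.range q).card := Finset.card_image_le
    _ = q := Finset.card_range q

lemma prevMark_of_succ_eq (w : Bits n) {i j : Fin n} (h : (j : ℕ) + 1 = i) :
    prevMark w i = w j := by
  have hsucc : i.castSucc = j.succ := Fin.ext h.symm
  rw [prevMark, hsucc, Fin.cons_succ]

lemma mem_window_of_succ_eq {q a : ℕ} {i j : Fin n} (hi : i ∈ window n q a)
    (hij : (j : ℕ) + 1 = i) (ha : (i : ℕ) ≠ a % n) : j ∈ window n q a := by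
  obtain ⟨d, hd, hid⟩ := mem_window.mp hi
  obtain ⟨d, rfl⟩ : ∃ d', d = d' + 1 := Nat.exists_eq_succ_of_ne_zero (by rintro rfl; exact ha hid)
  refine mem_window.mpr ⟨d, by omega, ?_⟩
  have hmod : j + 1 ≡ a + d + 1 [MOD n] := by
    rw [hij, Nat.ModEq, Nat.mod_eq_of_lt i.isLt, hid, add_assoc]
  exact (Nat.mod_eq_of_lt j.isLt).symm.trans (Nat.ModEq.add_right_cancel' 1 hmod)

/-- The second run occurs when the window wraps around the ring. -/
lemma runs_marksOf_window_le (n q a : ℕ) : runs (marksOf (window n q a)) ≤ 2 := by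
  rcases n.eq_zero_or_pos with rfl | hn
  · simp [runs]
  have hsub : (Finset.univ.filter fun i => marksOf (window n q a) i = 1 ∧
      prevMark (marksOf (window n q a)) i = 0) ⊆ {⟨0, hn⟩, ⟨a % n, Nat.mod_lt _ hn⟩} := by
    intro i hi
    obtain ⟨hmark, hprev⟩ := (Finset.mem_filter.mp hi).2
    simp only [Finset.mem_insert, Finset.mem_singleton, Fin.ext_iff]
    by_contra! hc
    have hpred : (i : ℕ) - 1 + 1 = i := Nat.sub_one_add_one hc.1
    rw [prevMark_of_succ_eq (j := ⟨i - 1, by omega⟩) _ hpred, marksOf_eq_zero] at hprev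
    exact hprev (mem_window_of_succ_eq (marksOf_eq_one.mp hmark) hpred hc.2)
  exact (Finset.card_le_card hsub).trans Finset.card_le_two

lemma PauliString.InWindow.isClustered {q : ℕ} {P : PauliString n}
    (h : PauliString.InWindow q P) : IsClustered 2 q P := by
  obtain ⟨a, ha⟩ := h
  exact ⟨marksOf (window n q a), within_marksOf fun i hi => mem_window.mpr (ha i hi),
    (weight_marksOf _).trans_le (card_window_le n q a), runs_marksOf_window_le n q a⟩

lemma exists_isClustered_ne_one (hn : 1 ≤ n) :
    ∃ P : PauliString n, IsClustered 1 1 P ∧ P ≠ PauliString.one n := by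
  refine ⟨Function.update (PauliString.one n) ⟨0, hn⟩ .X,
    isClustered_of_weight_le (Finset.card_le_one.mpr ?_),
    fun h => by simpa [PauliString.one] using congrFun h ⟨0, hn⟩⟩
  simp +contextual [Function.update_apply, PauliString.one]

lemma IsPauliSum.mono {S S' : PauliString n → Prop} {H : Hamiltonian n} (h : IsPauliSum S H)
    (hS : ∀ P, S P → S' P) : IsPauliSum S' H := by
  obtain ⟨c, hc, hH⟩ := h
  exact ⟨c, fun P hP => hS P (hc P hP), hH⟩

open Classical in
lemma le_signal_evolution (hn : 2 ≤ n) {b l : ℕ} (hb : 1 ≤ b) (hl : 1 ≤ l) {H : Hamiltonian n}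
    (hH : IsPauliSum (IsClustered b l) H) (t : ℝ) :
    1 / 2 * (1 / 16) ^ (2 * l) * (1 / (4 * (n : ℝ))) ^ (2 * b) ≤
      signal (coinCount n) (evolution (H, t)) := by
  set S : Finset (PauliString n) := {P | IsClustered b l P ∧ P ≠ PauliString.one n}
  have hne : S.Nonempty := by
    obtain ⟨P, hP, hP1⟩ := exists_isClustered_ne_one (one_le_two.trans hn)
    exact ⟨P, by simp [S, hP.mono hb hl, hP1]⟩
  have hsum : 1 ≤ ∑ p ∈ S ×ˢ S, transfer p.1 p.2 (evolution (H, t)) ^ 2 := by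
    rw [Finset.sum_product]
    refine one_le_sum_transfer_sq hne (by simp [S]) (hH.mono fun P hP => ?_) t
    simp [S, hP, Classical.em]
  have hcover (p) (hp : p ∈ S ×ˢ S) : ∃ w : Bits n,
      p ∈ nontrivialWithin w ×ˢ nontrivialWithin w ∧
        1 / 2 * (1 / 16) ^ (2 * l) * (1 / (4 * (n : ℝ))) ^ (2 * b) ≤
          markProb (coinCount n) w * (1 / 4) ^ weight w := by
    simp only [S, Finset.mem_product, Finset.mem_filter, Finset.mem_univ, true_and] at hp
    obtain ⟨w, hPw, hQw, hwl, hwb⟩ := hp.1.1.exists_within hp.2.1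
    refine ⟨w, ?_, le_markProb_coinCount hn w hwl hwb⟩
    simp [mem_nontrivialWithin, hPw, hQw, hp.1.2, hp.2.2]
  exact (le_mul_of_one_le_right (by positivity) hsum).trans
    (mul_sum_le_sum_mul_sum_of_cover
      (fun w => mul_nonneg (markProb_nonneg _ w) (by positivity)) (fun _ => sq_nonneg _) hcover)

lemma le_advantage_swapExperiment (D : (n : ℕ) → Measure (Hamiltonian n × ℝ))
    [∀ n, IsProbabilityMeasure (D n)] (hn : 2 ≤ n) {b l : ℕ} (hb : 1 ≤ b) (hl : 1 ≤ l)
    (hD : ∀ᵐ p ∂(D n), IsPauliSum (IsClustered b l) p.1) :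
    1 / 4 * (1 / 16) ^ (2 * l) * (1 / (4 * (n : ℝ))) ^ (2 * b) - (5 / 8) ^ n ≤
      advantage swapExperiment (fun n => evolutionEnsemble (D n)) n := by
  set δ : ℝ := 1 / 2 * (1 / 16) ^ (2 * l) * (1 / (4 * (n : ℝ))) ^ (2 * b) with hδ
  have hevol := (measurable_evolution n).aemeasurable (μ := D n)
  have hsignal : AEStronglyMeasurable (signal (coinCount n)) (evolutionEnsemble (D n)) :=
    (integrable_signal _ _).aestronglyMeasurable
  have hint : Integrable (fun p => signal (coinCount n) (evolution p)) (D n) :=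
    (integrable_map_measure hsignal hevol).mp (integrable_signal _ (evolutionEnsemble (D n)))
  have hensemble : δ ≤ ∫ U, signal (coinCount n) U ∂(evolutionEnsemble (D n)) := by
    rw [evolutionEnsemble, integral_map hevol hsignal]
    calc δ = ∫ _, δ ∂(D n) := by simp
      _ ≤ _ := integral_mono_ae (integrable_const _) hint
        (hD.mono fun p hp => le_signal_evolution hn hb hl hp p.2)
  have hhaar := integral_signal_haar_le (n := n) (k := coinCount n) (Nat.le_add_left 1 _)
  rw [advantage_swapExperiment]
  linarith [le_abs_self (∫ U, signal (coinCount n) U ∂(evolutionEnsemble (D n)) -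
    ∫ U, signal (coinCount n) U ∂(haar n))]

/-! ### Asymptotics -/

lemma not_negligible_of_frequently_le {f : ℕ → ℝ} {c r : ℝ} (hc : 0 < c) (hr : |r| < 1) (K : ℕ)
    (h : ∃ᶠ n : ℕ in atTop, c / (n : ℝ) ^ K - r ^ n ≤ f n) : ¬ Negligible f := by
  intro hneg
  have hlim : Tendsto (fun n : ℕ => (n : ℝ) ^ K * f n + (n : ℝ) ^ K * r ^ n) atTop (nhds 0) := by
    simpa using (hneg K).add (tendsto_pow_const_mul_const_pow_of_abs_lt_one K hr)
  obtain ⟨n, hle, hlt, hn⟩ :=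
    (h.and_eventually ((hlim.eventually_lt_const hc).and (eventually_ge_atTop 1))).exists
  have hpos : (0 : ℝ) < (n : ℝ) ^ K := pow_pos (by exact_mod_cast hn) K
  have hmul := mul_le_mul_of_nonneg_left hle hpos.le
  rw [mul_sub, mul_div_cancel₀ _ hpos.ne'] at hmul
  linarith

lemma exists_eventually_pow_le_pow {l : ℕ → ℕ}
    (hl : (fun n => (l n : ℝ)) =O[atTop] fun n : ℕ => Real.log n) {B : ℝ} (hB : 1 ≤ B) :
    ∃ K : ℕ, ∀ᶠ n : ℕ in atTop, B ^ l n ≤ (n : ℝ) ^ K := by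
  obtain ⟨C, hC⟩ := hl.bound
  obtain ⟨K, hK⟩ := exists_nat_ge (C * Real.log B)
  refine ⟨K, ?_⟩
  filter_upwards [hC, eventually_ge_atTop 1] with n hn hn1
  have hlog : 0 ≤ Real.log n := Real.log_natCast_nonneg n
  have hln : (l n : ℝ) ≤ C * Real.log n := by simpa [abs_of_nonneg hlog] using hn
  have : (0 : ℝ) < n := by exact_mod_cast hn1
  rw [← Real.log_le_log_iff (by positivity) (by positivity), Real.log_pow, Real.log_pow]
  calc l n * Real.log B ≤ C * Real.log n * Real.log B :=
        mul_le_mul_of_nonneg_right hln (Real.log_nonneg hB)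
    _ = C * Real.log B * Real.log n := by ring
    _ ≤ K * Real.log n := mul_le_mul_of_nonneg_right hK hlog

lemma isBigO_one_log_natCast : (fun _ : ℕ => (1 : ℝ)) =O[atTop] fun n : ℕ => Real.log n :=
  (Real.isLittleO_const_log_atTop.comp_tendsto tendsto_natCast_atTop_atTop).isBigO

lemma not_negligible_advantage_swapExperiment (D : (n : ℕ) → Measure (Hamiltonian n × ℝ))
    [∀ n, IsProbabilityMeasure (D n)] {b l : ℕ → ℕ}
    (hb : (fun n => (b n : ℝ)) =O[atTop] fun _ : ℕ => (1 : ℝ))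
    (hl : (fun n => (l n : ℝ)) =O[atTop] fun n : ℕ => Real.log n)
    (hD : ∃ᶠ n in atTop, ∀ᵐ p ∂(D n), IsPauliSum (IsClustered (b n) (l n)) p.1) :
    ¬ Negligible (advantage swapExperiment fun n => evolutionEnsemble (D n)) := by
  obtain ⟨C, hC⟩ := hb.bound
  obtain ⟨m, hm⟩ := exists_nat_ge C
  obtain ⟨K, hK⟩ := exists_eventually_pow_le_pow hl (B := 256) (by norm_num)
  refine not_negligible_of_frequently_le (c := 1 / 4 * (1 / 256) * (1 / 4) ^ (2 * (m + 1)))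
    (r := 5 / 8) (by positivity) (by norm_num [abs_lt]) (K + 2 * (m + 1)) ?_
  refine (hD.and_eventually (hC.and (hK.and (eventually_ge_atTop 2)))).mono ?_
  rintro n ⟨hDn, hbn, hln, hn⟩
  have : (0 : ℝ) < n := by exact_mod_cast (show 0 < n by omega)
  have hbm : b n ≤ m := by
    have hreal : (b n : ℝ) ≤ m := (show (b n : ℝ) ≤ C by simpa using hbn).trans hm
    exact_mod_cast hreal
  have hpow : (1 / 16 : ℝ) ^ (2 * (l n + 1)) = 1 / 256 * (1 / 256 ^ l n) := by
    rw [pow_mul, pow_succ', ← one_div_pow]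
    norm_num
  have hbound := le_advantage_swapExperiment D hn (b := m + 1) (l := l n + 1) (by omega) (by omega)
    (hDn.mono fun p hp => hp.mono fun P hP => hP.mono (by omega) (by omega))
  refine le_trans (sub_le_sub_right ?_ _) hbound
  calc 1 / 4 * (1 / 256) * (1 / 4) ^ (2 * (m + 1)) / (n : ℝ) ^ (K + 2 * (m + 1))
      = 1 / 4 * (1 / 256 * (1 / (n : ℝ) ^ K)) * (1 / (4 * (n : ℝ))) ^ (2 * (m + 1)) := by
        rw [pow_add, div_pow, div_pow, mul_pow]
        field_simp
    _ ≤ 1 / 4 * (1 / 256 * (1 / 256 ^ l n)) * (1 / (4 * (n : ℝ))) ^ (2 * (m + 1)) := by gcongr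
    _ = 1 / 4 * (1 / 16) ^ (2 * (l n + 1)) * (1 / (4 * (n : ℝ))) ^ (2 * (m + 1)) := by rw [hpow]

end NoGoPRU

end

open NoGoPRU MeasureTheory Filter in
theorem theorem2_general (D : (n : ℕ) → Measure (Hamiltonian n × ℝ))
    [∀ n, IsProbabilityMeasure (D n)] {b l : ℕ → ℕ}
    (hb : (fun n => (b n : ℝ)) =O[atTop] fun _ : ℕ => (1 : ℝ))
    (hl : (fun n => (l n : ℝ)) =O[atTop] fun n : ℕ => Real.log n)
    (hD : ∃ᶠ n in atTop, ∀ᵐ p ∂(D n), IsPauliSum (IsClustered (b n) (l n)) p.1) :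
    ¬ IsPRU (fun n => evolutionEnsemble (D n)) ∧
      ∃ A : Experiment, A.PolyTime ∧ (∀ n, (A n).ParallelQueries 2) ∧
        ¬ Negligible (advantage A fun n => evolutionEnsemble (D n)) := by
  have hadv := not_negligible_advantage_swapExperiment D hb hl hD
  exact ⟨fun hPRU => hadv (hPRU swapExperiment swapExperiment_polyTime), swapExperiment,
    swapExperiment_polyTime, fun n => parallelQueries_swapCircuit n _, hadv⟩

theorem theorem2
    (D : (n : ℕ) → MeasureTheory.Measure (NoGoPRU.Hamiltonian n × ℝ))
    [∀ n, MeasureTheory.IsProbabilityMeasure (D n)] (q : ℕ → ℕ) :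
    -- one-dimensional systems
    ((∀ n, ∀ᵐ p ∂(D n), NoGoPRU.IsLocal1D (q n) p.1) →
      (fun n => (q n : ℝ)) =O[Filter.atTop] (fun n : ℕ => Real.log n) →
      ¬ NoGoPRU.IsPRU (fun n => NoGoPRU.evolutionEnsemble (D n)) ∧
      ∃ A : NoGoPRU.Experiment, A.PolyTime ∧ (∀ n, (A n).ParallelQueries 2) ∧
        ¬ NoGoPRU.Negligible
          (NoGoPRU.advantage A fun n => NoGoPRU.evolutionEnsemble (D n))) ∧
    -- all-to-all connected systems
    ((∀ n, ∀ᵐ p ∂(D n), NoGoPRU.IsLocal (q n) p.1) →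
      (fun n => (q n : ℝ)) =O[Filter.atTop] (fun _ : ℕ => (1 : ℝ)) →
      ¬ NoGoPRU.IsPRU (fun n => NoGoPRU.evolutionEnsemble (D n)) ∧
      ∃ A : NoGoPRU.Experiment, A.PolyTime ∧ (∀ n, (A n).ParallelQueries 2) ∧
        ¬ NoGoPRU.Negligible
          (NoGoPRU.advantage A fun n => NoGoPRU.evolutionEnsemble (D n))) :=
  ⟨fun hD hq => theorem2_general D (Asymptotics.isBigO_const_const (2 : ℝ) one_ne_zero _) hq
      (.of_forall fun n => (hD n).mono fun _ hp => hp.mono fun _ hP => hP.isClustered),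
    fun hD hq => theorem2_general D hq (hq.trans NoGoPRU.isBigO_one_log_natCast)
      (.of_forall fun n => (hD n).mono fun _ hp => hp.mono fun _ hP =>
        NoGoPRU.isClustered_of_weight_le hP)⟩
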